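/- **Setting.** Let $M$ be a smooth (Hausdorff, $\sigma$-compact) $n$-manifold with a chronal cone bundle $C$, i.e. an open subset $C\subset TM$ whose fibres $C_x$ are non-empty open convex cones with $\bar C_x\cap(-\bar C_x)\subseteq\{0\}$; curves with velocity in $C$ are timelike, curves with velocity in $\bar C_x\setminus\{0\}$ (closure taken in $T_xM$) are causal. Assume $(M,C)$ is globally hyperbolic: there are no closed causal curves and all causal diamonds $J^+(x)\cap J^-(y)$ are compact. For $K\subseteq M$ let $I^{\pm}(K)$ be its chronological future/past and $I(K)=I^+(K)\cup I^-(K)\cup K$. For a smooth real vector bundle $V\to M$ of finite rank, $\Gamma_0(V)$ denotes smooth sections of compact support, $\Gamma_{\pm}(V)$ those with support contained in $\overline{I^{\pm}(K)}$ for some compact $K$, and $\Gamma_{SC}(V)$ those with support contained in $\overline{I(K)}$ for some compact $K$. Let $\tilde V^*=V^*\otimes|\Lambda|M$ be the bundle of dual densities ($|\Lambda|M\cong\Lambda^nT^*M$ if $M$ is oriented), with natural pairing $\langle\phi,\tilde\alpha^*\rangle=\int_M\phi\cdot\tilde\alpha^*$. All operators below are linear differential operators of finite order with smooth coefficients, and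 $A^*$ is the formal adjoint of $A$ for the natural pairing: for $A\colon\Gamma(V)\to\Gamma(W)$, $A^*\colon\Gamma(\tilde W^*)\to\Gamma(\tilde V^*)$; for $A\colon\Gamma(V)\to\Gamma(\tilde V^*)$, also $A^*\colon\Gamma(V)\to\Gamma(\tilde V^*)$; and similarly in the other cases. An operator $f\colon\Gamma(V)\to\Gamma(\tilde V^*)$ is *Green hyperbolic* (for $C$) if for each sign $f\colon\Gamma_\pm(V)\to\Gamma_\pm(\tilde V^*)$ is bijective and the solution $\phi$ of $f[\phi]=\tilde\alpha^*$ satisfies $\operatorname{supp}\phi\subseteq\overline{I^\pm(\operatorname{supp}\tilde\alpha^*)}$; its inverses are $G_\pm$ and $G=G_+-G_-\colon\Gamma_0(\tilde V^*)\to\Gamma_{SC}(V)$ is its causal Green function. Call $f$ *hyperbolic* if both $f$ and $f^*$ are Green hyperbolic for $C$, and write $G^*$ for the causal Green function of $f^*$. **Data.** Let $F,E,E',P,P'$ be vector bundles over $M$ and $f\colon\Gamma(F)\to\Gamma(\tilde F^*)$ a hyperbolic operator. *Constraints:* hyperbolic operators $h$ on $E$ and $h'$ on $E'$ (with $H^*$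 the causal Green function of $h^*$) and differential operators $c'\colon\Gamma(E')\to\Gamma(F)$, $c\colon\Gamma(F)\to\Gamma(E)$, $q'\colon\Gamma(\tilde E'^*)\to\Gamma(\tilde F^*)$, $q\colon\Gamma(\tilde F^*)\to\Gamma(\tilde E^*)$ with $$h\circ c=q\circ f,\qquad f\circ c'=q'\circ h',\qquad c\circ c'=0,\qquad q\circ q'=0 .$$ They are *globally parametrizable* if the pairing $\langle[\xi],[\tilde\alpha^*]\rangle=\int_M\xi\cdot\tilde\alpha^*$ (equal to the Green pairing of $\xi$ with $G[\tilde\alpha^*]$) between the vertical cohomologies in solutions $$\frac{\{\xi\in G^*[\Gamma_0(\tilde F^*)] : q'^*[\xi]=0\}}{q^*[H^*[\Gamma_0(\tilde E^*)]]} \quad\text{and}\quad \frac{\{\tilde\alpha^*\in\Gamma_0(\tilde F^*) : q[\tilde\alpha^*]\in h[\Gamma_0(E)]\}}{q'[\Gamma_0(\tilde E'^*)]+f[\Gamma_0(F)]}$$ is non-degenerate in both arguments. *Gauge transformations:* hyperbolic operators $k$ on $P$ and $k'$ on $P'$ and differential operators $g\colon\Gamma(P)\to\Gamma(F)$, $g'\colon\Gamma(F)\to\Gamma(P')$,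 $s\colon\Gamma(\tilde P^*)\to\Gamma(\tilde F^*)$, $s'\colon\Gamma(\tilde F^*)\to\Gamma(\tilde P'^*)$ with $$f\circ g=s\circ k,\qquad k'\circ g'=s'\circ f,\qquad g'\circ g=0,\qquad s'\circ s=0 .$$ They are *globally recognizable* if the natural pairing, induced by $\int_M\psi\cdot\tilde\alpha^*$, between $$\frac{\{\psi\in\Gamma_{SC}(F) : g'[\psi]=0\}}{g[\Gamma_{SC}(P)]} \quad\text{and}\quad \frac{\{\tilde\alpha^*\in\Gamma_0(\tilde F^*) : g^*[\tilde\alpha^*]=0\}}{g'^*[\Gamma_0(\tilde P'^*)]}$$ is non-degenerate in both arguments. (Here $f,c,g,\dots$ stand for the linearizations at a background solution $\phi$.) The formal gauge invariant solutions tangent and cotangent spaces are $$T_\phi\bar{\mathcal S}=\frac{\{\psi\in\Gamma_{SC}(F) : f[\psi]=0,\ c[\psi]=0\}}{\{g[\varepsilon] : \varepsilon\in\Gamma_{SC}(P),\ f[g[\varepsilon]]=0,\ c[g[\varepsilon]]=0\}},$$ $$T^*_\phi\bar{\mathcal S}=\frac{\{\tilde\alpha^*\in\Gamma_0(\tilde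 F^*) : g^*[\tilde\alpha^*]=g^*[f^*[\xi]+c^*[\tilde\varepsilon^*]]\text{ for some }\xi\in\Gamma_0(F),\ \tilde\varepsilon^*\in\Gamma_0(\tilde E^*)\}}{\{f^*[\xi]+c^*[\tilde\varepsilon^*] : \xi\in\Gamma_0(F),\ \tilde\varepsilon^*\in\Gamma_0(\tilde E^*)\}} .$$ **Lemma.** If the constraints are globally parametrizable and the gauge transformations are globally recognizable, then the (well-defined) natural pairing $$T_\phi\bar{\mathcal S}\times T^*_\phi\bar{\mathcal S}\to\mathbb R,\qquad \langle[\psi],[\tilde\alpha^*]\rangle=\int_M\psi\cdot\tilde\alpha^*$$ is non-degenerate in both arguments. -/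

import Mathlib

open Set Bundle MeasureTheory
open scoped Manifold Topology ContDiff

set_option linter.unusedSectionVars false

noncomputable section

namespace CovariantPhaseSpace

section Geometry

universe u w

variable (n : ℕ) (M : Type w) [TopologicalSpace M] [ChartedSpace (EuclideanSpace ℝ (Fin n)) M]
  [IsManifold (𝓡 n) ∞ M]

/-- A smooth real vector bundle of finite rank over the `n`-manifold `M`. -/
structure VBundle where
  /-- model fibre -/
  Fib : Type u
  /-- fibres -/
  E : M → Type u
  [normedAddCommGroup : NormedAddCommGroup Fib]
  [normedSpace : NormedSpace ℝ Fib]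
  [finiteDimensional : FiniteDimensional ℝ Fib]
  [addCommGroup : ∀ x, AddCommGroup (E x)]
  [module : ∀ x, Module ℝ (E x)]
  [topFibre : ∀ x, TopologicalSpace (E x)]
  [topTotal : TopologicalSpace (TotalSpace Fib E)]
  [fiberBundle : FiberBundle Fib E]
  [vectorBundle : VectorBundle ℝ Fib E]
  [contMDiff : ContMDiffVectorBundle ∞ Fib E (𝓡 n)]

attribute [instance] VBundle.normedAddCommGroup VBundle.normedSpace VBundle.finiteDimensional
  VBundle.addCommGroup VBundle.module VBundle.topFibre VBundle.topTotal VBundle.fiberBundle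
  VBundle.vectorBundle VBundle.contMDiff

variable {n M}

/-- `Γ(V)`: smooth sections. -/
abbrev VBundle.Sec (V : VBundle.{u, w} n M) : Type _ := ContMDiffSection (𝓡 n) V.Fib ∞ V.E

theorem clm_det_comp {V : Type*} [NormedAddCommGroup V] [NormedSpace ℝ V] (A B : V →L[ℝ] V) :
    (A.comp B).det = A.det * B.det := by
  simp only [ContinuousLinearMap.det]
  exact LinearMap.det_comp _ _

theorem contDiff_clm_det {V : Type*} [NormedAddCommGroup V] [NormedSpace ℝ V]
    [FiniteDimensional ℝ V] : ContDiff ℝ ∞ (fun A : V →L[ℝ] V => A.det) := by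
  classical
  let b := Module.finBasis ℝ V
  have h : (fun A : V →L[ℝ] V => A.det) =
      fun A : V →L[ℝ] V => ∑ σ : Equiv.Perm (Fin (Module.finrank ℝ V)),
        ((Equiv.Perm.sign σ : ℤ) : ℝ) * ∏ i, b.repr (A (b i)) (σ i) := by
    funext A
    rw [ContinuousLinearMap.det, ← LinearMap.det_toMatrix b, Matrix.det_apply']
    simp [LinearMap.toMatrix_apply]
  rw [h]
  refine ContDiff.sum fun σ _ => contDiff_const.mul (contDiff_prod fun i _ => ?_)
  let L : (V →L[ℝ] V) →ₗ[ℝ] ℝ :=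
    (b.coord (σ i)).comp ((ContinuousLinearMap.apply ℝ V (b i)) : (V →L[ℝ] V) →ₗ[ℝ] V)
  exact (LinearMap.toContinuousLinearMap L).contDiff

variable (n M) in
/-- The cocycle of the line bundle of densities: passing from chart `i` to chart `j` multiplies by
`|det ∂xᵢ/∂xⱼ|`. -/
def densityCore : VectorBundleCore ℝ M ℝ (atlas (EuclideanSpace ℝ (Fin n)) M) where
  baseSet i := i.1.source
  isOpen_baseSet i := i.1.open_source
  indexAt := achart (EuclideanSpace ℝ (Fin n))
  mem_baseSet_at := mem_chart_source (EuclideanSpace ℝ (Fin n))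
  coordChange i j x :=
    |((tangentBundleCore (𝓡 n) M).coordChange j i x).det| • ContinuousLinearMap.id ℝ ℝ
  coordChange_self i x hx v := by
    have : (tangentBundleCore (𝓡 n) M).coordChange i i x = ContinuousLinearMap.id ℝ _ := by
      ext1 v
      exact (tangentBundleCore (𝓡 n) M).coordChange_self i x hx v
    rw [this]
    simp [ContinuousLinearMap.det]
  continuousOn_coordChange i j := by
    have h := (tangentBundleCore (𝓡 n) M).continuousOn_coordChange j i
    have h2 := (ContinuousLinearMap.continuous_det (𝕜 := ℝ)
      (E := EuclideanSpace ℝ (Fin n))).comp_continuousOn h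
    refine ContinuousOn.smul (h2.abs.mono ?_) continuousOn_const
    rw [inter_comm]; rfl
  coordChange_comp := by
    rintro i j k x ⟨⟨hi, hj⟩, hk⟩ v
    have : (tangentBundleCore (𝓡 n) M).coordChange k i x =
        ((tangentBundleCore (𝓡 n) M).coordChange j i x).comp
          ((tangentBundleCore (𝓡 n) M).coordChange k j x) := by
      ext1 v
      exact ((tangentBundleCore (𝓡 n) M).coordChange_comp k j i x ⟨⟨hk, hj⟩, hi⟩ v).symm
    rw [this, clm_det_comp, abs_mul]
    simp only [smul_apply, ContinuousLinearMap.id_apply, smul_eq_mul]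
    ring

instance densityCore_isContMDiff : (densityCore n M).IsContMDiff (𝓡 n) ∞ where
  contMDiffOn_coordChange i j := by
    have : IsManifold (𝓡 n) (∞ + 1) M := by simpa
    have hT : (tangentBundleCore (𝓡 n) M).IsContMDiff (𝓡 n) ∞ := tangentBundleCore.isContMDiff
    have h := (tangentBundleCore (𝓡 n) M).contMDiffOn_coordChange (𝓡 n) (n := ∞) j i
    have hdet : ContDiff ℝ ∞ (fun A : EuclideanSpace ℝ (Fin n) →L[ℝ] EuclideanSpace ℝ (Fin n) =>
        A.det) := contDiff_clm_det
    intro x hx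
    have hne : ((tangentBundleCore (𝓡 n) M).coordChange j i x).det ≠ 0 := by
      have e : ((tangentBundleCore (𝓡 n) M).coordChange j i x).comp
          ((tangentBundleCore (𝓡 n) M).coordChange i j x) = ContinuousLinearMap.id ℝ _ := by
        ext1 v
        exact ((tangentBundleCore (𝓡 n) M).coordChange_comp i j i x ⟨hx, hx.1⟩ v).trans
          ((tangentBundleCore (𝓡 n) M).coordChange_self i x hx.1 v)
      intro h0
      have := clm_det_comp ((tangentBundleCore (𝓡 n) M).coordChange j i x)
        ((tangentBundleCore (𝓡 n) M).coordChange i j x)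
      rw [e, h0, zero_mul] at this
      simp [ContinuousLinearMap.det] at this
    have h1 : ContMDiffWithinAt (𝓡 n) 𝓘(ℝ, ℝ) ∞
        (fun x => ((tangentBundleCore (𝓡 n) M).coordChange j i x).det)
        ((densityCore n M).baseSet i ∩ (densityCore n M).baseSet j) x :=
      hdet.contMDiff.contMDiffAt.comp_contMDiffWithinAt x (h.mono (by rw [inter_comm]; rfl) x hx)
    have h2 : ContMDiffWithinAt (𝓡 n) 𝓘(ℝ, ℝ) ∞
        (fun x => |((tangentBundleCore (𝓡 n) M).coordChange j i x).det|)
        ((densityCore n M).baseSet i ∩ (densityCore n M).baseSet j) x :=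
      (contDiffAt_abs hne).contMDiffAt.comp_contMDiffWithinAt x h1
    exact h2.smul contMDiffWithinAt_const

variable (n M) in
/-- The line bundle `|Λ|M` of densities. -/
abbrev Density : M → Type := (densityCore n M).Fiber

instance (x : M) : IsTopologicalAddGroup (Density n M x) :=
  inferInstanceAs (IsTopologicalAddGroup ℝ)

instance (x : M) : ContinuousSMul ℝ (Density n M x) :=
  inferInstanceAs (ContinuousSMul ℝ ℝ)

/-- The densitized dual bundle `Ṽ* = V* ⊗ |Λ|M = Hom(V, |Λ|M)`; on an oriented manifold `|Λ|M` is
the bundle `ΛⁿT*M` of volume forms. -/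
def VBundle.dual (V : VBundle.{u, w} n M) : VBundle.{u, w} n M where
  Fib := V.Fib →L[ℝ] ℝ
  E x := V.E x →L[ℝ] Density n M x

/-- The pointwise natural pairing of a section of `V` with a section of `Ṽ*`, a smooth density. -/
def pairDensity {V : VBundle.{u, w} n M} (φ : V.Sec) (α : V.dual.Sec) :
    ContMDiffSection (𝓡 n) ℝ ∞ (Density n M) where
  toFun x := (show V.E x →L[ℝ] Density n M x from α x) (φ x)
  contMDiff_toFun := ContMDiff.clm_bundle_apply (F₁ := V.Fib) (E₁ := V.E) (F₂ := ℝ)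
    (E₂ := Density n M) (b := fun x : M => x)
    (ϕ := fun x => (show V.E x →L[ℝ] Density n M x from α x)) α.contMDiff φ.contMDiff

/-- Support of a section. -/
def secSupp {V : VBundle.{u, w} n M} (φ : V.Sec) : Set M := closure {x | φ x ≠ 0}

theorem secSupp_add {V : VBundle.{u, w} n M} (φ ψ : V.Sec) :
    secSupp (φ + ψ) ⊆ secSupp φ ∪ secSupp ψ := by
  unfold secSupp
  rw [← closure_union]
  refine closure_mono fun x hx => ?_
  by_contra h
  rw [mem_union, not_or] at h
  refine hx ?_
  show φ x + ψ x = 0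
  rw [not_not.1 h.1, not_not.1 h.2, add_zero]

theorem secSupp_smul {V : VBundle.{u, w} n M} (r : ℝ) (φ : V.Sec) :
    secSupp (r • φ) ⊆ secSupp φ := by
  refine closure_mono fun x hx h => hx ?_
  show r • φ x = 0
  rw [h, smul_zero]

theorem pairDensity_supp {V : VBundle.{u, w} n M} {φ : V.Sec} {α : V.dual.Sec}
    (h : IsCompact (secSupp φ ∩ secSupp α)) :
    IsCompact (closure {x | pairDensity φ α x ≠ 0}) := by
  refine h.of_isClosed_subset isClosed_closure (closure_minimal ?_
    (isClosed_closure.inter isClosed_closure))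
  intro x hx
  refine ⟨subset_closure fun h0 => hx ?_, subset_closure fun h0 => hx ?_⟩
  · show (show V.E x →L[ℝ] Density n M x from α x) (φ x) = 0
    rw [h0, map_zero]
  · show (show V.E x →L[ℝ] Density n M x from α x) (φ x) = 0
    rw [h0]; rfl

/-- The coefficient of a density with respect to Lebesgue measure in the chart centred at `c`. -/
def densityCoeff (σ : ContMDiffSection (𝓡 n) ℝ ∞ (Density n M)) (c x : M) : ℝ :=
  (trivializationAt ℝ (Density n M) c ⟨x, σ x⟩).2

theorem densityCoeff_add (σ τ : ContMDiffSection (𝓡 n) ℝ ∞ (Density n M)) {c x : M}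
    (hx : x ∈ (chartAt (EuclideanSpace ℝ (Fin n)) c).source) :
    densityCoeff (σ + τ) c x = densityCoeff σ c x + densityCoeff τ c x :=
  ((trivializationAt ℝ (Density n M) c).linear ℝ (b := x) hx).1 (σ x) (τ x)

theorem densityCoeff_smul (r : ℝ) (σ : ContMDiffSection (𝓡 n) ℝ ∞ (Density n M)) {c x : M}
    (hx : x ∈ (chartAt (EuclideanSpace ℝ (Fin n)) c).source) :
    densityCoeff (r • σ) c x = r * densityCoeff σ c x :=
  ((trivializationAt ℝ (Density n M) c).linear ℝ (b := x) hx).2 r (σ x)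

theorem densityCoeff_zero {σ : ContMDiffSection (𝓡 n) ℝ ∞ (Density n M)} {c x : M}
    (hx : x ∈ (chartAt (EuclideanSpace ℝ (Fin n)) c).source) (h : σ x = 0) :
    densityCoeff σ c x = 0 := by
  unfold densityCoeff
  rw [h]
  exact ((trivializationAt ℝ (Density n M) c).linear ℝ (b := x) hx).map_zero

theorem continuousOn_densityCoeff (σ : ContMDiffSection (𝓡 n) ℝ ∞ (Density n M)) (c : M) :
    ContinuousOn (densityCoeff σ c) (chartAt (EuclideanSpace ℝ (Fin n)) c).source := by
  intro x hx
  have h1 : ContinuousAt (fun x => (⟨x, σ x⟩ : TotalSpace ℝ (Density n M))) x :=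
    σ.contMDiff.continuous.continuousAt
  have h2 : ContinuousAt (trivializationAt ℝ (Density n M) c)
      (⟨x, σ x⟩ : TotalSpace ℝ (Density n M)) :=
    (trivializationAt ℝ (Density n M) c).continuousAt
      ((trivializationAt ℝ (Density n M) c).mem_source.2 hx)
  exact (continuous_snd.continuousAt.comp (ContinuousAt.comp
    (f := fun x => (⟨x, σ x⟩ : TotalSpace ℝ (Density n M))) h2 h1)).continuousWithinAt

section Integral

variable [T2Space M] [SigmaCompactSpace M]

variable (n M) in
/-- A smooth partition of unity subordinate to the chart domains. -/
def chartPartition : SmoothPartitionOfUnity M (𝓡 n) M univ :=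
  (SmoothPartitionOfUnity.exists_isSubordinate_chartAt_source (𝓡 n) M).choose

theorem chartPartition_subordinate :
    (chartPartition n M).IsSubordinate
      (fun x => (chartAt (EuclideanSpace ℝ (Fin n)) x).source) :=
  (SmoothPartitionOfUnity.exists_isSubordinate_chartAt_source (𝓡 n) M).choose_spec

/-- The integrand of `∫ σ` in the chart centred at `c`. -/
def chartIntegrand (σ : ContMDiffSection (𝓡 n) ℝ ∞ (Density n M)) (c : M)
    (y : EuclideanSpace ℝ (Fin n)) : ℝ :=
  chartPartition n M c ((extChartAt (𝓡 n) c).symm y) *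
    densityCoeff σ c ((extChartAt (𝓡 n) c).symm y)

/-- The integral `∫_M σ` of a compactly supported density: the sum over the charts of the Lebesgue
integrals of `ρ_c σ_c`, where `ρ` is a partition of unity and `σ_c` the coefficient of `σ`. -/
def integralDensity (σ : ContMDiffSection (𝓡 n) ℝ ∞ (Density n M)) : ℝ :=
  ∑ᶠ c : M, ∫ y in (extChartAt (𝓡 n) c).target, chartIntegrand σ c y

theorem chartIntegrand_eq_zero {σ : ContMDiffSection (𝓡 n) ℝ ∞ (Density n M)} {c : M}
    {y : EuclideanSpace ℝ (Fin n)} (hy : y ∈ (extChartAt (𝓡 n) c).target)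
    (h : (extChartAt (𝓡 n) c).symm y ∉
      tsupport (chartPartition n M c) ∩ closure {x | σ x ≠ 0}) :
    chartIntegrand σ c y = 0 := by
  have hs : (extChartAt (𝓡 n) c).symm y ∈ (chartAt (EuclideanSpace ℝ (Fin n)) c).source := by
    rw [← extChartAt_source (𝓡 n)]; exact (extChartAt (𝓡 n) c).map_target hy
  unfold chartIntegrand
  by_cases h1 : (extChartAt (𝓡 n) c).symm y ∈ tsupport (chartPartition n M c)
  · have h2 : σ ((extChartAt (𝓡 n) c).symm y) = 0 := by
      by_contra h3
      exact h ⟨h1, subset_closure h3⟩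
    rw [densityCoeff_zero hs h2, mul_zero]
  · rw [image_eq_zero_of_notMem_tsupport h1, zero_mul]

theorem integrableOn_chartIntegrand {σ : ContMDiffSection (𝓡 n) ℝ ∞ (Density n M)}
    (hσ : IsCompact (closure {x | σ x ≠ 0})) (c : M) :
    IntegrableOn (chartIntegrand σ c) (extChartAt (𝓡 n) c).target := by
  set K : Set M := tsupport (chartPartition n M c) ∩ closure {x | σ x ≠ 0} with hK
  have hKc : IsCompact K := hσ.inter_left (isClosed_tsupport _)
  have hKs : K ⊆ (extChartAt (𝓡 n) c).source := by
    rw [extChartAt_source]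
    exact inter_subset_left.trans (chartPartition_subordinate c)
  have hK' : IsCompact (extChartAt (𝓡 n) c '' K) :=
    hKc.image_of_continuousOn ((continuousOn_extChartAt c).mono hKs)
  have hK't : extChartAt (𝓡 n) c '' K ⊆ (extChartAt (𝓡 n) c).target := by
    rintro _ ⟨x, hx, rfl⟩
    exact (extChartAt (𝓡 n) c).map_source (hKs hx)
  have hmap : MapsTo (extChartAt (𝓡 n) c).symm (extChartAt (𝓡 n) c).target
      (chartAt (EuclideanSpace ℝ (Fin n)) c).source := by
    intro y hy
    rw [← extChartAt_source (𝓡 n)]; exact (extChartAt (𝓡 n) c).map_target hy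
  have hcont : ContinuousOn (chartIntegrand σ c) (extChartAt (𝓡 n) c).target := by
    refine ContinuousOn.mul ?_ ?_
    · exact (chartPartition n M c).contMDiff.continuous.comp_continuousOn
        (continuousOn_extChartAt_symm c)
    · exact (continuousOn_densityCoeff σ c).comp (continuousOn_extChartAt_symm c) hmap
  refine ((hcont.mono hK't).integrableOn_compact hK').of_forall_sdiff_eq_zero
    (isOpen_extChartAt_target c).measurableSet ?_
  rintro y ⟨hy, hyK⟩
  refine chartIntegrand_eq_zero hy fun h => hyK ⟨_, h, (extChartAt (𝓡 n) c).right_inv hy⟩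

theorem finite_support_chartIntegral {σ : ContMDiffSection (𝓡 n) ℝ ∞ (Density n M)}
    (hσ : IsCompact (closure {x | σ x ≠ 0})) :
    (Function.support fun c : M =>
      ∫ y in (extChartAt (𝓡 n) c).target, chartIntegrand σ c y).Finite := by
  refine ((chartPartition n M).locallyFinite.closure.finite_nonempty_inter_compact hσ).subset ?_
  intro c hc
  by_contra h
  refine hc (setIntegral_eq_zero_of_forall_eq_zero fun y hy => chartIntegrand_eq_zero hy ?_)
  intro h2
  exact h ⟨_, h2⟩

theorem integralDensity_add {σ τ : ContMDiffSection (𝓡 n) ℝ ∞ (Density n M)}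
    (hσ : IsCompact (closure {x | σ x ≠ 0})) (hτ : IsCompact (closure {x | τ x ≠ 0})) :
    integralDensity (σ + τ) = integralDensity σ + integralDensity τ := by
  unfold integralDensity
  rw [← finsum_add_distrib (finite_support_chartIntegral hσ) (finite_support_chartIntegral hτ)]
  refine finsum_congr fun c => ?_
  rw [← integral_add (integrableOn_chartIntegrand hσ c) (integrableOn_chartIntegrand hτ c)]
  refine setIntegral_congr_fun (isOpen_extChartAt_target c).measurableSet fun y hy => ?_
  have hs : (extChartAt (𝓡 n) c).symm y ∈ (chartAt (EuclideanSpace ℝ (Fin n)) c).source := by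
    rw [← extChartAt_source (𝓡 n)]; exact (extChartAt (𝓡 n) c).map_target hy
  simp only [chartIntegrand, densityCoeff_add σ τ hs, mul_add]

theorem integralDensity_smul (r : ℝ) (σ : ContMDiffSection (𝓡 n) ℝ ∞ (Density n M)) :
    integralDensity (r • σ) = r * integralDensity σ := by
  unfold integralDensity
  rw [← smul_eq_mul, smul_finsum]
  refine finsum_congr fun c => ?_
  rw [smul_eq_mul, ← integral_const_mul]
  refine setIntegral_congr_fun (isOpen_extChartAt_target c).measurableSet fun y hy => ?_
  have hs : (extChartAt (𝓡 n) c).symm y ∈ (chartAt (EuclideanSpace ℝ (Fin n)) c).source := by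
    rw [← extChartAt_source (𝓡 n)]; exact (extChartAt (𝓡 n) c).map_target hy
  simp only [chartIntegrand, densityCoeff_smul r σ hs]
  ring

/-- The natural pairing `⟨φ, α̃*⟩ = ∫_M φ · α̃*`. -/
def natPairing {V : VBundle.{u, w} n M} (φ : V.Sec) (α : V.dual.Sec) : ℝ :=
  integralDensity (pairDensity φ α)

theorem natPairing_add_left {V : VBundle.{u, w} n M} {φ ψ : V.Sec} {α : V.dual.Sec}
    (h : IsCompact (secSupp φ ∩ secSupp α)) (h' : IsCompact (secSupp ψ ∩ secSupp α)) :
    natPairing (φ + ψ) α = natPairing φ α + natPairing ψ α := by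
  unfold natPairing
  rw [← integralDensity_add (pairDensity_supp h) (pairDensity_supp h')]
  congr 1
  ext x
  exact map_add (show V.E x →L[ℝ] Density n M x from α x) (φ x) (ψ x)

theorem natPairing_add_right {V : VBundle.{u, w} n M} {φ : V.Sec} {α β : V.dual.Sec}
    (h : IsCompact (secSupp φ ∩ secSupp α)) (h' : IsCompact (secSupp φ ∩ secSupp β)) :
    natPairing φ (α + β) = natPairing φ α + natPairing φ β := by
  unfold natPairing
  rw [← integralDensity_add (pairDensity_supp h) (pairDensity_supp h')]
  congr 1

theorem natPairing_smul_left {V : VBundle.{u, w} n M} (r : ℝ) (φ : V.Sec) (α : V.dual.Sec) :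
    natPairing (r • φ) α = r * natPairing φ α := by
  unfold natPairing
  rw [← integralDensity_smul]
  congr 1
  ext x
  exact map_smul (show V.E x →L[ℝ] Density n M x from α x) r (φ x)

theorem natPairing_smul_right {V : VBundle.{u, w} n M} (r : ℝ) (φ : V.Sec) (α : V.dual.Sec) :
    natPairing φ (r • α) = r * natPairing φ α := by
  unfold natPairing
  rw [← integralDensity_smul]
  congr 1

end Integral


/-! ### Differential operators and formal adjoints -/

/-- The section `φ` written in the preferred chart of `M` and trivialization of `V` at `x`. -/
def localRep {V : VBundle.{u, w} n M} (φ : V.Sec) (x : M) (y : EuclideanSpace ℝ (Fin n)) : V.Fib :=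
  (trivializationAt V.Fib V.E x
    ⟨(extChartAt (𝓡 n) x).symm y, φ ((extChartAt (𝓡 n) x).symm y)⟩).2

/-- `j^k_x φ = 0`: all partial derivatives of `φ` of order at most `k` vanish at `x`. -/
def JetVanishes {V : VBundle.{u, w} n M} (φ : V.Sec) (k : ℕ) (x : M) : Prop :=
  ∀ i ≤ k, iteratedFDeriv ℝ i (localRep φ x) (extChartAt (𝓡 n) x x) = 0

/-- A linear differential operator `Γ(V) → Γ(W)` of finite order: `A[φ](x)` depends only on the
`k`-jet of `φ` at `x`, for some `k` independent of `φ` and `x`. -/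
structure DiffOp (V W : VBundle.{u, w} n M) where
  /-- the map on sections -/
  toLin : V.Sec →ₗ[ℝ] W.Sec
  finite_order : ∃ k : ℕ, ∀ (φ : V.Sec) (x : M), JetVanishes φ k x → toLin φ x = 0

instance (V W : VBundle.{u, w} n M) : CoeFun (DiffOp V W) (fun _ => V.Sec → W.Sec) :=
  ⟨fun A => A.toLin⟩

theorem DiffOp.supp_subset {V W : VBundle.{u, w} n M} (A : DiffOp V W) (φ : V.Sec) :
    secSupp (A φ) ⊆ secSupp φ := by
  refine closure_minimal (fun x hx => ?_) isClosed_closure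
  by_contra hn
  obtain ⟨k, hk⟩ := A.finite_order
  refine hx (hk φ x fun i _ => ?_)
  have h1 : ∀ᶠ z in 𝓝 x, φ z = 0 := by
    filter_upwards [isClosed_closure.isOpen_compl.mem_nhds hn] with z hz
    by_contra h
    exact hz (subset_closure h)
  have h2 : ∀ᶠ z in 𝓝 x, z ∈ (trivializationAt V.Fib V.E x).baseSet :=
    (trivializationAt V.Fib V.E x).open_baseSet.mem_nhds
      (FiberBundle.mem_baseSet_trivializationAt' x)
  have h3 : Filter.Tendsto (extChartAt (𝓡 n) x).symm (𝓝 (extChartAt (𝓡 n) x x)) (𝓝 x) := by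
    have := (continuousAt_extChartAt_symm (I := 𝓡 n) x).tendsto
    rwa [extChartAt_to_inv] at this
  have h4 : localRep φ x =ᶠ[𝓝 (extChartAt (𝓡 n) x x)] fun _ => (0 : V.Fib) := by
    filter_upwards [h3.eventually (h1.and h2)] with y hy
    unfold localRep
    rw [hy.1]
    exact ((trivializationAt V.Fib V.E x).linear ℝ hy.2).map_zero
  rw [(h4.iteratedFDeriv ℝ i).eq_of_nhds]
  simp

/-- `Γ₀(V)`: sections of compact support. -/
def secZero (V : VBundle.{u, w} n M) : Submodule ℝ V.Sec where
  carrier := {φ | IsCompact (secSupp φ)}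
  zero_mem' := by simp [secSupp]
  add_mem' {φ ψ} hφ hψ := (hφ.union hψ).of_isClosed_subset isClosed_closure (secSupp_add φ ψ)
  smul_mem' r φ hφ := hφ.of_isClosed_subset isClosed_closure (secSupp_smul r φ)

/-- The operator restricted to compactly supported sections. -/
def DiffOp.on0 {V W : VBundle.{u, w} n M} (A : DiffOp V W) : secZero V →ₗ[ℝ] secZero W :=
  A.toLin.restrict fun φ hφ =>
    IsCompact.of_isClosed_subset hφ isClosed_closure (A.supp_subset φ)

/-! ### Causal structure -/

variable (n M) in
/-- A chronal cone bundle: an open subset `C` of the manifold `TM` whose fibres (the future directed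
timelike vectors) are proper cones, i.e. non-empty, open, convex and salient. -/
structure ChronalCone where
  /-- the cone of future directed timelike vectors at `x` -/
  cone : ∀ x : M, Set (TangentSpace (𝓡 n) x)
  isOpen_total : IsOpen {p : TangentBundle (𝓡 n) M | p.2 ∈ cone p.1}
  nonempty : ∀ x, (cone x).Nonempty
  convex : ∀ x, Convex ℝ (cone x)
  smul_mem : ∀ x, ∀ v ∈ cone x, ∀ r : ℝ, 0 < r → r • v ∈ cone x
  salient : ∀ x, ∀ v ∈ closure (cone x), -v ∈ closure (cone x) → v = 0

/-- There is a smooth curve from `x` to `y` whose velocity lies everywhere in `S`. -/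
def CurveIn (S : ∀ x : M, Set (TangentSpace (𝓡 n) x)) (x y : M) : Prop :=
  ∃ (γ : ℝ → M) (a b : ℝ), a < b ∧ γ a = x ∧ γ b = y ∧
    ∀ t ∈ Icc a b, ContMDiffAt 𝓘(ℝ, ℝ) (𝓡 n) ∞ γ t ∧
      (mfderiv 𝓘(ℝ, ℝ) (𝓡 n) γ t : ℝ →L[ℝ] TangentSpace (𝓡 n) (γ t)) 1 ∈ S (γ t)

/-- The two directions of time. -/
inductive TimeDir where
  | future
  | past

namespace ChronalCone

variable (C : ChronalCone n M)

/-- `x ≪ y`: some (piecewise smooth) future directed timelike curve leads from `x` to `y`. -/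
def Chron : M → M → Prop := Relation.TransGen (CurveIn C.cone)

/-- Some (piecewise smooth) future directed causal curve leads from `x` to `y`. -/
def Causal : M → M → Prop :=
  Relation.TransGen (CurveIn fun x => closure (C.cone x) \ {0})

/-- Global hyperbolicity, in its standard formulation: there are no closed causal curves, and the
causal diamonds `J⁺(x) ∩ J⁻(y)` are compact. -/
structure IsGloballyHyperbolic : Prop where
  causal : ∀ x, ¬ C.Causal x x
  compact_diamond : ∀ x y,
    IsCompact {z | (z = x ∨ C.Causal x z) ∧ (z = y ∨ C.Causal z y)}

/-- The chronological future `I⁺(K)` or past `I⁻(K)` of a set. -/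
def infl : TimeDir → Set M → Set M
  | .future, K => {y | ∃ x ∈ K, C.Chron x y}
  | .past, K => {y | ∃ x ∈ K, C.Chron y x}

/-- `I(K) = I⁺(K) ∪ I⁻(K) ∪ K`. -/
def inflBoth (K : Set M) : Set M := C.infl .future K ∪ C.infl .past K ∪ K

theorem infl_mono {K L : Set M} (h : K ⊆ L) (d : TimeDir) : C.infl d K ⊆ C.infl d L := by
  cases d <;> exact fun y ⟨x, hx, hxy⟩ => ⟨x, h hx, hxy⟩

theorem infl_subset_inflBoth (K : Set M) (d : TimeDir) : C.infl d K ⊆ C.inflBoth K := by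
  cases d
  · exact fun y hy => Or.inl (Or.inl hy)
  · exact fun y hy => Or.inl (Or.inr hy)

theorem inflBoth_mono {K L : Set M} (h : K ⊆ L) : C.inflBoth K ⊆ C.inflBoth L :=
  union_subset_union (union_subset_union (C.infl_mono h _) (C.infl_mono h _)) h

/-- Through every point there is a short timelike curve. -/
theorem exists_timelike (x : M) : ∃ (γ : ℝ → M) (ε : ℝ), 0 < ε ∧ γ 0 = x ∧ ContinuousAt γ 0 ∧
    ∀ t ∈ Ioo (-ε) ε, ContMDiffAt 𝓘(ℝ, ℝ) (𝓡 n) ∞ γ t ∧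
      (mfderiv 𝓘(ℝ, ℝ) (𝓡 n) γ t : ℝ →L[ℝ] TangentSpace (𝓡 n) (γ t)) 1 ∈ C.cone (γ t) := by
  obtain ⟨v, hv⟩ := C.nonempty x
  set y₀ := extChartAt (𝓡 n) x x with hy₀
  have hy₀t : y₀ ∈ (extChartAt (𝓡 n) x).target := mem_extChartAt_target x
  have hmd : HasMFDerivAt 𝓘(ℝ, EuclideanSpace ℝ (Fin n)) (𝓡 n) (extChartAt (𝓡 n) x).symm y₀
      (mfderiv 𝓘(ℝ, EuclideanSpace ℝ (Fin n)) (𝓡 n) (extChartAt (𝓡 n) x).symm y₀) := by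
    refine MDifferentiableAt.hasMFDerivAt ?_
    exact ((contMDiffOn_extChartAt_symm (n := ∞) x).contMDiffAt
      ((isOpen_extChartAt_target x).mem_nhds hy₀t)).mdifferentiableAt (by simp)
  have hsurj : ∃ w : EuclideanSpace ℝ (Fin n),
      (mfderiv 𝓘(ℝ, EuclideanSpace ℝ (Fin n)) (𝓡 n) (extChartAt (𝓡 n) x).symm y₀ :
        EuclideanSpace ℝ (Fin n) → EuclideanSpace ℝ (Fin n)) w = v := by
    have h := isInvertible_mfderivWithin_extChartAt_symm (I := 𝓡 n) hy₀t
    rw [ModelWithCorners.Boundaryless.range_eq_univ, mfderivWithin_univ] at h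
    exact h.bijective.surjective v
  obtain ⟨w, hw⟩ := hsurj
  let l : ℝ → EuclideanSpace ℝ (Fin n) := fun t => y₀ + t • w
  have hl : ContMDiff 𝓘(ℝ, ℝ) 𝓘(ℝ, EuclideanSpace ℝ (Fin n)) ∞ l :=
    ContDiff.contMDiff (contDiff_const.add (contDiff_id.smul contDiff_const))
  have hl0 : l 0 = y₀ := by simp [l]
  let U : Set ℝ := l ⁻¹' (extChartAt (𝓡 n) x).target
  have hU : IsOpen U := (isOpen_extChartAt_target x).preimage hl.continuous
  have h0U : (0 : ℝ) ∈ U := by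
    show l 0 ∈ (extChartAt (𝓡 n) x).target
    rw [hl0]; exact hy₀t
  let γ : ℝ → M := fun t => (extChartAt (𝓡 n) x).symm (l t)
  have hγU : ContMDiffOn 𝓘(ℝ, ℝ) (𝓡 n) ∞ γ U :=
    (contMDiffOn_extChartAt_symm (n := ∞) x).comp hl.contMDiffOn (fun t ht => ht)
  have hγ0 : γ 0 = x := by
    show (extChartAt (𝓡 n) x).symm (l 0) = x
    rw [hl0]; exact extChartAt_to_inv x
  have hd0 : (mfderiv 𝓘(ℝ, ℝ) (𝓡 n) γ 0 : ℝ → EuclideanSpace ℝ (Fin n)) 1 = v := by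
    have h1 : HasMFDerivAt 𝓘(ℝ, ℝ) 𝓘(ℝ, EuclideanSpace ℝ (Fin n)) l 0
        ((ContinuousLinearMap.id ℝ ℝ).smulRight w) := by
      refine HasFDerivAt.hasMFDerivAt ?_
      exact ((hasFDerivAt_id (𝕜 := ℝ) (0 : ℝ)).smul_const w).const_add y₀
    have h2 := HasMFDerivAt.comp (f := l) (0 : ℝ) (by rw [hl0]; exact hmd) h1
    have h3 := h2.mfderiv
    have h4 : mfderiv 𝓘(ℝ, ℝ) (𝓡 n) γ 0 = _ := h3
    rw [h4]
    refine Eq.trans ?_ hw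
    show (mfderiv 𝓘(ℝ, EuclideanSpace ℝ (Fin n)) (𝓡 n) (extChartAt (𝓡 n) x).symm y₀ :
        EuclideanSpace ℝ (Fin n) → EuclideanSpace ℝ (Fin n)) ((1 : ℝ) • w) = _
    rw [one_smul]
  let T : ℝ → TangentBundle (𝓡 n) M := fun t => ⟨γ t,
    (mfderiv 𝓘(ℝ, ℝ) (𝓡 n) γ t : ℝ →L[ℝ] TangentSpace (𝓡 n) (γ t)) 1⟩
  have hT : ContinuousOn T U := by
    have h1 := hγU.continuousOn_tangentMapWithin (by simp) hU.uniqueMDiffOn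
    have h2 : Continuous (fun t : ℝ => (⟨t, (1 : ℝ)⟩ : TangentBundle 𝓘(ℝ, ℝ) ℝ)) :=
      (tangentBundleModelSpaceHomeomorph 𝓘(ℝ, ℝ)).symm.continuous.comp
        (continuous_id.prodMk continuous_const)
    refine (h1.comp h2.continuousOn (fun t ht => ht)).congr fun t ht => ?_
    show T t = (⟨γ t, (mfderivWithin 𝓘(ℝ, ℝ) (𝓡 n) γ U t :
      ℝ →L[ℝ] TangentSpace (𝓡 n) (γ t)) 1⟩ : TangentBundle (𝓡 n) M)
    rw [mfderivWithin_of_isOpen hU ht]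
  have hT0 : T 0 ∈ {p : TangentBundle (𝓡 n) M | p.2 ∈ C.cone p.1} := by
    show (mfderiv 𝓘(ℝ, ℝ) (𝓡 n) γ 0 : ℝ → EuclideanSpace ℝ (Fin n)) 1 ∈ C.cone (γ 0)
    rw [hd0, hγ0]
    exact hv
  have hev : ∀ᶠ t in 𝓝 (0 : ℝ), t ∈ U ∧ T t ∈ {p : TangentBundle (𝓡 n) M | p.2 ∈ C.cone p.1} :=
    Filter.Eventually.and (hU.mem_nhds h0U) ((hT.continuousAt (hU.mem_nhds h0U)).eventually
      (C.isOpen_total.mem_nhds hT0))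
  obtain ⟨ε, hε, hball⟩ := Metric.eventually_nhds_iff.1 hev
  refine ⟨γ, ε, hε, hγ0, (hγU.continuousOn.continuousAt (hU.mem_nhds h0U)), fun t ht => ?_⟩
  have h := hball (y := t) (by rw [Real.dist_eq, sub_zero]; exact abs_lt.2 ht)
  exact ⟨hγU.contMDiffAt (hU.mem_nhds h.1), h.2⟩

theorem subset_closure_infl (d : TimeDir) (K : Set M) : K ⊆ closure (C.infl d K) := by
  intro x hx
  obtain ⟨γ, ε, hε, h0, hc, hγ⟩ := C.exists_timelike x
  rw [ContinuousAt, h0] at hc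
  cases d
  · refine mem_closure_of_tendsto (hc.mono_left (nhdsWithin_le_nhds (s := Ioi 0))) ?_
    filter_upwards [Ioo_mem_nhdsGT hε] with t ht
    exact ⟨x, hx, .single ⟨γ, 0, t, ht.1, h0, rfl, fun s hs =>
      hγ s ⟨by linarith [hs.1], by linarith [hs.2, ht.2]⟩⟩⟩
  · refine mem_closure_of_tendsto (hc.mono_left (nhdsWithin_le_nhds (s := Iio 0))) ?_
    filter_upwards [Ioo_mem_nhdsLT (neg_lt_zero.2 hε)] with t ht
    exact ⟨x, hx, .single ⟨γ, t, 0, ht.2, rfl, h0, fun s hs =>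
      hγ s ⟨by linarith [hs.1, ht.1], by linarith [hs.2]⟩⟩⟩

/-- `Γ₊(V)` (`d = future`) and `Γ₋(V)` (`d = past`): sections of retarded, respectively advanced,
support. -/
def secDir (d : TimeDir) (V : VBundle.{u, w} n M) : Submodule ℝ V.Sec where
  carrier := {φ | ∃ K : Set M, IsCompact K ∧ secSupp φ ⊆ closure (C.infl d K)}
  zero_mem' := ⟨∅, isCompact_empty, by simp [secSupp]⟩
  add_mem' := by
    rintro φ ψ ⟨K, hK, h⟩ ⟨L, hL, h'⟩
    refine ⟨K ∪ L, hK.union hL, (secSupp_add φ ψ).trans (union_subset ?_ ?_)⟩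
    · exact h.trans (closure_mono (C.infl_mono subset_union_left d))
    · exact h'.trans (closure_mono (C.infl_mono subset_union_right d))
  smul_mem' := fun r φ ⟨K, hK, h⟩ => ⟨K, hK, (secSupp_smul r φ).trans h⟩

/-- `Γ_SC(V)`: sections of spacelike compact support. -/
def secSC (V : VBundle.{u, w} n M) : Submodule ℝ V.Sec where
  carrier := {φ | ∃ K : Set M, IsCompact K ∧ secSupp φ ⊆ closure (C.inflBoth K)}
  zero_mem' := ⟨∅, isCompact_empty, by simp [secSupp]⟩
  add_mem' := by
    rintro φ ψ ⟨K, hK, h⟩ ⟨L, hL, h'⟩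
    refine ⟨K ∪ L, hK.union hL, (secSupp_add φ ψ).trans (union_subset ?_ ?_)⟩
    · exact h.trans (closure_mono (C.inflBoth_mono subset_union_left))
    · exact h'.trans (closure_mono (C.inflBoth_mono subset_union_right))
  smul_mem' := fun r φ ⟨K, hK, h⟩ => ⟨K, hK, (secSupp_smul r φ).trans h⟩

theorem secZero_le_secDir (d : TimeDir) (V : VBundle.{u, w} n M) : secZero V ≤ C.secDir d V :=
  fun _ hφ => ⟨_, hφ, C.subset_closure_infl d _⟩

theorem secDir_le_secSC (d : TimeDir) (V : VBundle.{u, w} n M) : C.secDir d V ≤ C.secSC V :=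
  fun _ ⟨K, hK, h⟩ => ⟨K, hK, h.trans (closure_mono (C.infl_subset_inflBoth K d))⟩

end ChronalCone

/-- The operator restricted to sections of retarded / advanced support. -/
def DiffOp.onDir {V W : VBundle.{u, w} n M} (A : DiffOp V W) (C : ChronalCone n M) (d : TimeDir) :
    C.secDir d V →ₗ[ℝ] C.secDir d W :=
  A.toLin.restrict fun φ ⟨K, hK, h⟩ => ⟨K, hK, (A.supp_subset φ).trans h⟩

/-- The operator restricted to sections of spacelike compact support. -/
def DiffOp.onSC {V W : VBundle.{u, w} n M} (A : DiffOp V W) (C : ChronalCone n M) :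
    C.secSC V →ₗ[ℝ] C.secSC W :=
  A.toLin.restrict fun φ ⟨K, hK, h⟩ => ⟨K, hK, (A.supp_subset φ).trans h⟩

/-! ### Green hyperbolicity -/

/-- `f` is Green hyperbolic with respect to `C`: for `α̃* ∈ Γ±(Ṽ*)` the equation `f[φ] = α̃*` has
exactly one solution in `Γ±(V)`, and its support lies in the closure of `I±(supp α̃*)`. -/
structure IsGreenHyperbolic (C : ChronalCone n M) {V : VBundle.{u, w} n M}
    (f : DiffOp V V.dual) : Prop where
  existsUnique : ∀ (d : TimeDir) (α : C.secDir d V.dual), ∃! φ : C.secDir d V, f.onDir C d φ = α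
  supp_subset : ∀ (d : TimeDir) (φ : C.secDir d V),
    secSupp (φ : V.Sec) ⊆ closure (C.infl d (secSupp (f φ)))

namespace IsGreenHyperbolic

variable {C : ChronalCone n M} {V : VBundle.{u, w} n M} {f : DiffOp V V.dual}

/-- The retarded (`d = future`) and advanced (`d = past`) Green functions `G±`, the two-sided
inverses of `f` on `Γ±`. -/
def green (hf : IsGreenHyperbolic C f) (d : TimeDir) : C.secDir d V.dual →ₗ[ℝ] C.secDir d V :=
  (LinearEquiv.ofBijective (f.onDir C d)
    ((Function.bijective_iff_existsUnique _).2 (hf.existsUnique d))).symm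

/-- `G±` restricted to compactly supported dual densities and regarded as a map to `Γ_SC(V)`. -/
def greenSC (hf : IsGreenHyperbolic C f) (d : TimeDir) : secZero V.dual →ₗ[ℝ] C.secSC V :=
  (Submodule.inclusion (C.secDir_le_secSC d V)).comp
    ((hf.green d).comp (Submodule.inclusion (C.secZero_le_secDir d V.dual)))

/-- The causal Green function `G = G₊ - G₋ : Γ₀(Ṽ*) → Γ_SC(V)`. -/
def causal (hf : IsGreenHyperbolic C f) : secZero V.dual →ₗ[ℝ] C.secSC V :=
  hf.greenSC .future - hf.greenSC .past

theorem op_greenSC (hf : IsGreenHyperbolic C f) (d : TimeDir) (α : secZero V.dual) :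
    f (hf.greenSC d α : V.Sec) = α := by
  have h := LinearEquiv.apply_symm_apply (LinearEquiv.ofBijective (f.onDir C d)
    ((Function.bijective_iff_existsUnique _).2 (hf.existsUnique d)))
    (Submodule.inclusion (C.secZero_le_secDir d V.dual) α)
  exact congrArg Subtype.val h

theorem op_causal (hf : IsGreenHyperbolic C f) (α : secZero V.dual) :
    f.onSC C (hf.causal α) = 0 := by
  apply Subtype.ext
  show f.toLin ((hf.greenSC .future α : V.Sec) - (hf.greenSC .past α : V.Sec)) = 0
  rw [map_sub]
  exact sub_eq_zero.2 ((hf.op_greenSC .future α).trans (hf.op_greenSC .past α).symm)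

end IsGreenHyperbolic

section Main

variable [T2Space M] [SigmaCompactSpace M]

/-- `A : Γ(V) → Γ(W)` and `A* : Γ(W̃*) → Γ(Ṽ*)` are formally adjoint:
`∫ A[φ] · β = ∫ φ · A*[β]` whenever `supp φ ∩ supp β` is compact. -/
def IsAdjoint {V W : VBundle.{u, w} n M} (A : DiffOp V W) (A' : DiffOp W.dual V.dual) : Prop :=
  ∀ (φ : V.Sec) (β : W.dual.Sec), IsCompact (secSupp φ ∩ secSupp β) →
    natPairing (A φ) β = natPairing φ (A' β)

/-- `f, f* : Γ(V) → Γ(Ṽ*)` are formally adjoint: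
`∫ f[φ] · ψ = ∫ φ · f*[ψ]` whenever `supp φ ∩ supp ψ` is compact. -/
def IsAdjointOp {V : VBundle.{u, w} n M} (f f' : DiffOp V V.dual) : Prop :=
  ∀ φ ψ : V.Sec, IsCompact (secSupp φ ∩ secSupp ψ) →
    natPairing ψ (f φ) = natPairing φ (f' ψ)

/-- A linear differential operator `f : Γ(V) → Γ(Ṽ*)` together with its formal adjoint `f*`, both
Green hyperbolic for the same causal structure. -/
structure HyperbolicOp (C : ChronalCone n M) (V : VBundle.{u, w} n M) where
  /-- the operator `f` -/
  op : DiffOp V V.dual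
  /-- the formal adjoint `f*` -/
  adj : DiffOp V V.dual
  isAdjoint : IsAdjointOp op adj
  green : IsGreenHyperbolic C op
  green_adj : IsGreenHyperbolic C adj

/-- The causal Green function `G` of `f`. -/
def HyperbolicOp.G {C : ChronalCone n M} {V : VBundle.{u, w} n M} (f : HyperbolicOp C V) :
    secZero V.dual →ₗ[ℝ] C.secSC V := f.green.causal

/-- The causal Green function `G*` of `f*`. -/
def HyperbolicOp.Gadj {C : ChronalCone n M} {V : VBundle.{u, w} n M} (f : HyperbolicOp C V) :
    secZero V.dual →ₗ[ℝ] C.secSC V := f.green_adj.causal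

/-- The natural pairing `Γ_SC(V) × Γ₀(Ṽ*) → ℝ`. -/
def pairSC (C : ChronalCone n M) (V : VBundle.{u, w} n M) :
    C.secSC V →ₗ[ℝ] secZero V.dual →ₗ[ℝ] ℝ :=
  LinearMap.mk₂ ℝ (fun φ α => natPairing (φ : V.Sec) (α : V.dual.Sec))
    (fun _ _ α => natPairing_add_left (α.2.inter_left isClosed_closure)
      (α.2.inter_left isClosed_closure))
    (fun r _ _ => natPairing_smul_left r _ _)
    (fun _ α β => natPairing_add_right (α.2.inter_left isClosed_closure)
      (β.2.inter_left isClosed_closure))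
    (fun r _ _ => natPairing_smul_right r _ _)

theorem pairSC_adj {C : ChronalCone n M} {V W : VBundle.{u, w} n M} {A : DiffOp V W}
    {A' : DiffOp W.dual V.dual} (h : IsAdjoint A A') (φ : C.secSC V) (β : secZero W.dual) :
    pairSC C W (A.onSC C φ) β = pairSC C V φ (A'.on0 β) :=
  h φ β (β.2.inter_left isClosed_closure)

/-- The pairing of `Γ_SC(V)`-valued and `Γ₀(V)`-valued arguments of `f` and `f*`. -/
theorem pairSC_op {C : ChronalCone n M} {V : VBundle.{u, w} n M} (f : HyperbolicOp C V)
    (φ : C.secSC V) (ρ : secZero V) (h : f.op.onSC C φ = 0) :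
    pairSC C V φ (f.adj.on0 ρ) = 0 := by
  have h1 : natPairing (ρ : V.Sec) (f.op (φ : V.Sec)) = natPairing (φ : V.Sec) (f.adj (ρ : V.Sec)) :=
    f.isAdjoint φ ρ (ρ.2.inter_left isClosed_closure)
  have h2 : f.op (φ : V.Sec) = 0 := congrArg Subtype.val h
  rw [h2] at h1
  have h3 := natPairing_smul_right 0 (ρ : V.Sec) (0 : V.dual.Sec)
  rw [zero_smul, zero_mul] at h3
  exact h1.symm.trans h3

theorem pairSC_adj_op {C : ChronalCone n M} {V : VBundle.{u, w} n M} (f : HyperbolicOp C V)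
    (ξ : C.secSC V) (ρ : secZero V) (h : f.adj.onSC C ξ = 0) :
    pairSC C V ξ (f.op.on0 ρ) = 0 := by
  have h1 : natPairing (ξ : V.Sec) (f.op (ρ : V.Sec)) = natPairing (ρ : V.Sec) (f.adj (ξ : V.Sec)) :=
    f.isAdjoint ρ ξ (ρ.2.inter_right isClosed_closure)
  have h2 : f.adj (ξ : V.Sec) = 0 := congrArg Subtype.val h
  rw [h2] at h1
  have h3 := natPairing_smul_right 0 (ρ : V.Sec) (0 : V.dual.Sec)
  rw [zero_smul, zero_mul] at h3
  exact h1.trans h3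

/-! ### Subquotients and the pairings they inherit -/

/-- The subquotient `Z / (Z ∩ B)`. -/
abbrev Subquot {X : Type*} [AddCommGroup X] [Module ℝ X] (Z B : Submodule ℝ X) : Type _ :=
  Z ⧸ B.submoduleOf Z

/-- A bilinear pairing descended to subquotients: `⟨[x], [y]⟩ = ⟨x, y⟩`. -/
def subquotPairing {X Y : Type*} [AddCommGroup X] [Module ℝ X] [AddCommGroup Y] [Module ℝ Y]
    (p : X →ₗ[ℝ] Y →ₗ[ℝ] ℝ) (ZX BX : Submodule ℝ X) (ZY BY : Submodule ℝ Y)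
    (hX : ∀ x ∈ BX, x ∈ ZX → ∀ y ∈ ZY, p x y = 0) (hY : ∀ x ∈ ZX, ∀ y ∈ BY, p x y = 0) :
    Subquot ZX BX →ₗ[ℝ] Subquot ZY BY →ₗ[ℝ] ℝ :=
  (BX.submoduleOf ZX).liftQ
    { toFun := fun x => (BY.submoduleOf ZY).liftQ ((p x).comp ZY.subtype)
        (fun y hy => hY x x.2 y hy)
      map_add' := fun x x' => by
        ext y
        show p ((x + x' : ZX) : X) y = p x y + p x' y
        simp
      map_smul' := fun r x => by
        ext y
        show p ((r • x : ZX) : X) y = r • p x y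
        simp }
    (fun x hx => by ext y; exact hX x hx x.2 y y.2)

@[simp] theorem subquotPairing_mk {X Y : Type*} [AddCommGroup X] [Module ℝ X] [AddCommGroup Y]
    [Module ℝ Y] (p : X →ₗ[ℝ] Y →ₗ[ℝ] ℝ) (ZX BX : Submodule ℝ X) (ZY BY : Submodule ℝ Y)
    (hX : ∀ x ∈ BX, x ∈ ZX → ∀ y ∈ ZY, p x y = 0) (hY : ∀ x ∈ ZX, ∀ y ∈ BY, p x y = 0)
    (x : ZX) (y : ZY) :
    subquotPairing p ZX BX ZY BY hX hY (Submodule.Quotient.mk x) (Submodule.Quotient.mk y) =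
      p x y := rfl

/-! ### Constraints -/

/-- Parametrizable, hyperbolically integrable constraints for `f`: the operators
`c' : Γ(E') → Γ(F)`, `c : Γ(F) → Γ(E)` with `c ∘ c' = 0` and `q' : Γ(Ẽ'*) → Γ(F̃*)`,
`q : Γ(F̃*) → Γ(Ẽ*)` with `q ∘ q' = 0`, intertwined by the hyperbolic operators `h'`, `f`, `h`,
together with their formal adjoints. -/
structure Constraints {C : ChronalCone n M} {F : VBundle.{u, w} n M} (f : HyperbolicOp C F)
    (E E' : VBundle.{u, w} n M) where
  /-- the consistency subsystem `h` -/
  h : HyperbolicOp C E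
  h' : HyperbolicOp C E'
  /-- the constraints -/
  c : DiffOp F E
  cAdj : DiffOp E.dual F.dual
  c' : DiffOp E' F
  c'Adj : DiffOp F.dual E'.dual
  q : DiffOp F.dual E.dual
  qAdj : DiffOp E F
  q' : DiffOp E'.dual F.dual
  q'Adj : DiffOp F E'
  isAdjoint_c : IsAdjoint c cAdj
  isAdjoint_c' : IsAdjoint c' c'Adj
  isAdjoint_q : IsAdjoint qAdj q
  isAdjoint_q' : IsAdjoint q'Adj q'
  h_c : ∀ φ, h.op (c φ) = q (f.op φ)
  f_c' : ∀ ζ, f.op (c' ζ) = q' (h'.op ζ)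
  c_c' : ∀ ζ, c (c' ζ) = 0
  q_q' : ∀ β, q (q' β) = 0

namespace Constraints

variable {C : ChronalCone n M} {F E E' : VBundle.{u, w} n M} {f : HyperbolicOp C F}
  (𝒞 : Constraints f E E')

/-- Cocycles at `Γ₀(F̃*)` modulo `im f`. -/
def solCocycles : Submodule ℝ (secZero F.dual) :=
  (LinearMap.range 𝒞.h.op.on0).comap 𝒞.q.on0

/-- Coboundaries at `Γ₀(F̃*)` modulo `im f`. -/
def solCoboundaries : Submodule ℝ (secZero F.dual) :=
  LinearMap.range 𝒞.q'.on0 ⊔ LinearMap.range f.op.on0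

/-- Cocycles of the adjoint diagram at `Γ_SC(F)` restricted to `im G*`. -/
def adjSolCocycles : Submodule ℝ (C.secSC F) :=
  LinearMap.range f.Gadj ⊓ LinearMap.ker (𝒞.q'Adj.onSC C)

/-- Coboundaries of the adjoint diagram at `Γ_SC(F)` restricted to `im G*`: the images under `q*`
of the elements of `im H*`. -/
def adjSolCoboundaries : Submodule ℝ (C.secSC F) :=
  (LinearMap.range 𝒞.h.Gadj).map (𝒞.qAdj.onSC C)

/-- The pairing `⟨[G[α̃*]]_c, [ξ]_{c*}⟩_G = ∫ α̃* · ξ` between the vertical cohomologies in solutions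
`H^c_SC(F, f)`, the cohomology of the column at `Γ₀(F̃*)` modulo `im f`, and `H^{c*}_SC(F, f*)`, the
cohomology of the adjoint column at `Γ_SC(F)` restricted to `im G*`. -/
def solCohomologyPairing :
    Subquot 𝒞.adjSolCocycles 𝒞.adjSolCoboundaries →ₗ[ℝ]
      Subquot 𝒞.solCocycles 𝒞.solCoboundaries →ₗ[ℝ] ℝ :=
  subquotPairing (pairSC C F) _ _ _ _
    (by
      rintro _ ⟨_, ⟨ε, rfl⟩, rfl⟩ _ α ⟨ρ, hρ⟩
      rw [pairSC_adj 𝒞.isAdjoint_q, ← hρ]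
      exact pairSC_adj_op 𝒞.h _ ρ (𝒞.h.green_adj.op_causal ε))
    (by
      rintro _ ⟨⟨β, rfl⟩, hξ⟩ α hα
      obtain ⟨_, ⟨ε, rfl⟩, _, ⟨ρ, rfl⟩, rfl⟩ := Submodule.mem_sup.1 hα
      rw [map_add, ← pairSC_adj 𝒞.isAdjoint_q', LinearMap.mem_ker.1 hξ, map_zero,
        LinearMap.zero_apply, zero_add]
      exact pairSC_adj_op f _ ρ (f.green_adj.op_causal β))

/-- The constraints are globally parametrizable. -/
def GloballyParametrizable : Prop := 𝒞.solCohomologyPairing.Nondegenerate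

end Constraints

/-! ### Gauge transformations -/

/-- Recognizable gauge transformations for `f`: the gauge generator `g : Γ(P) → Γ(F)`, the
operator of gauge invariant field combinations `g' : Γ(F) → Γ(P')` with `g' ∘ g = 0`, and
`s : Γ(P̃*) → Γ(F̃*)`, `s' : Γ(F̃*) → Γ(P̃'*)` with `s' ∘ s = 0`, intertwined by the hyperbolic
operators `k`, `f`, `k'`, together with their formal adjoints. -/
structure Gauge {C : ChronalCone n M} {F : VBundle.{u, w} n M} (f : HyperbolicOp C F)
    (P P' : VBundle.{u, w} n M) where
  k : HyperbolicOp C P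
  k' : HyperbolicOp C P'
  /-- the generator of linearized gauge transformations -/
  g : DiffOp P F
  gAdj : DiffOp F.dual P.dual
  /-- the gauge invariant field combinations -/
  g' : DiffOp F P'
  g'Adj : DiffOp P'.dual F.dual
  s : DiffOp P.dual F.dual
  sAdj : DiffOp F P
  s' : DiffOp F.dual P'.dual
  s'Adj : DiffOp P' F
  isAdjoint_g : IsAdjoint g gAdj
  isAdjoint_g' : IsAdjoint g' g'Adj
  isAdjoint_s : IsAdjoint sAdj s
  isAdjoint_s' : IsAdjoint s'Adj s'
  f_g : ∀ ε, f.op (g ε) = s (k.op ε)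
  k'_g' : ∀ φ, k'.op (g' φ) = s' (f.op φ)
  g'_g : ∀ ε, g' (g ε) = 0
  s'_s : ∀ β, s' (s β) = 0

namespace Gauge

variable {C : ChronalCone n M} {F P P' : VBundle.{u, w} n M} {f : HyperbolicOp C F}
  (𝒢 : Gauge f P P')

/-- The natural pairing between `H^g_SC(F) = ker g' / im g` (spacelike compact supports) and
`H^{g*}_0(F̃*) = ker g* / im g'*` (compact supports). -/
def cohomologyPairing :
    Subquot (LinearMap.ker (𝒢.g'.onSC C)) (LinearMap.range (𝒢.g.onSC C)) →ₗ[ℝ]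
      Subquot (LinearMap.ker 𝒢.gAdj.on0) (LinearMap.range 𝒢.g'Adj.on0) →ₗ[ℝ] ℝ :=
  subquotPairing (pairSC C F) _ _ _ _
    (by
      rintro _ ⟨ε, rfl⟩ _ α hα
      rw [pairSC_adj 𝒢.isAdjoint_g, LinearMap.mem_ker.1 hα, map_zero])
    (by
      rintro ψ hψ _ ⟨β, rfl⟩
      rw [← pairSC_adj 𝒢.isAdjoint_g', LinearMap.mem_ker.1 hψ, map_zero, LinearMap.zero_apply])

/-- The gauge transformations are globally recognizable. -/
def GloballyRecognizable : Prop := 𝒢.cohomologyPairing.Nondegenerate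

end Gauge

/-! ### Formal tangent and cotangent spaces -/

section Formal

variable {C : ChronalCone n M} {F E E' P P' : VBundle.{u, w} n M} {f : HyperbolicOp C F}
  (𝒞 : Constraints f E E') (𝒢 : Gauge f P P')

/-- Linearized solutions: `ψ ∈ Γ_SC(F)` with `f[ψ] = 0` and `c[ψ] = 0`. -/
def linSolutions : Submodule ℝ (C.secSC F) :=
  LinearMap.ker (f.op.onSC C) ⊓ LinearMap.ker (𝒞.c.onSC C)

/-- The trivial dual densities `f*[ξ] + c*[ε̃*]` with `ξ ∈ Γ₀(F)`, `ε̃* ∈ Γ₀(Ẽ*)`. -/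
def trivialDuals : Submodule ℝ (secZero F.dual) :=
  LinearMap.range f.adj.on0 ⊔ LinearMap.range 𝒞.cAdj.on0

/-- The `α̃* ∈ Γ₀(F̃*)` with `g*[α̃*] = g*[f*[ξ] + c*[ε̃*]]` for some `ξ ∈ Γ₀(F)`, `ε̃* ∈ Γ₀(Ẽ*)`. -/
def gaugeInvDuals : Submodule ℝ (secZero F.dual) :=
  ((trivialDuals 𝒞).map 𝒢.gAdj.on0).comap 𝒢.gAdj.on0

/-- The formal gauge invariant solutions tangent space `T_φS̄`: linearized solutions modulo the
pure gauge solutions `g[ε]`, `ε ∈ Γ_SC(P)`. -/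
abbrev TangentSbar : Type _ := Subquot (linSolutions 𝒞) (LinearMap.range (𝒢.g.onSC C))

/-- The formal gauge invariant solutions cotangent space `T*_φS̄`: the `α̃*` in `gaugeInvDuals` modulo
`f*[ξ] + c*[ε̃*]`, `ξ ∈ Γ₀(F)`, `ε̃* ∈ Γ₀(Ẽ*)`. -/
abbrev CotangentSbar : Type _ := Subquot (gaugeInvDuals 𝒞 𝒢) (trivialDuals 𝒞)

theorem pairSC_trivial {ψ : C.secSC F} (hψ : ψ ∈ linSolutions 𝒞) {α : secZero F.dual}
    (hα : α ∈ trivialDuals 𝒞) : pairSC C F ψ α = 0 := by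
  obtain ⟨_, ⟨ξ, rfl⟩, _, ⟨ε, rfl⟩, rfl⟩ := Submodule.mem_sup.1 hα
  rw [map_add, pairSC_op f ψ ξ hψ.1, ← pairSC_adj 𝒞.isAdjoint_c, LinearMap.mem_ker.1 hψ.2,
    map_zero, LinearMap.zero_apply, zero_add]

/-- The natural pairing `⟨[ψ], [α̃*]⟩ = ∫_M ψ · α̃*` between `T_φS̄` and `T*_φS̄`. -/
def sbarPairing : TangentSbar 𝒞 𝒢 →ₗ[ℝ] CotangentSbar 𝒞 𝒢 →ₗ[ℝ] ℝ :=
  subquotPairing (pairSC C F) _ _ _ _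
    (by
      rintro _ ⟨ε, rfl⟩ hψ α ⟨β, hβ, hαβ⟩
      rw [pairSC_adj 𝒢.isAdjoint_g, ← hαβ, ← pairSC_adj 𝒢.isAdjoint_g]
      exact pairSC_trivial 𝒞 hψ hβ)
    (fun _ hψ _ hα => pairSC_trivial 𝒞 hψ hα)

end Formal

end Main

end Geometry
end CovariantPhaseSpace

end

open CovariantPhaseSpace

/-! Write ⟨·,·⟩ for the natural pairing. The two halves of non-degeneracy are independent.

First argument. Suppose ψ annihilates every gauge invariant covector. Since g' ∘ g = 0 gives g* ∘
g'* = 0, every g'*[β] is one of these, so ⟨g'[ψ], β⟩ = ⟨ψ, g'*[β]⟩ = 0 for all β of compact support,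
and hence g'[ψ] = 0. Thus ψ defines a class in the gauge cohomology which pairs to zero with all of
ker g*, and recognizability makes it pure gauge (`mem_range_g_of_forall_pairSC`).

Second argument. Suppose α annihilates every linearized solution. If β is a cocycle, q[β] = h[ρ],
then G[β] is a linearized solution because c G β = H q β = H h ρ = 0. As G and -G* are adjoint,
G*[α] annihilates all cocycles; testing on the cocycles q'[β] gives q'* G* α = 0. Parametrizability
now yields G* α = q* H* ε, which equals G* c* ε by the adjoint of h ∘ c = q ∘ f. So α - c*[ε] lies
in ker G* = f*[Γ₀(F)], that is, α is trivial (`mem_trivialDuals_of_forall_pairSC`).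

Two analytic facts carry this. One is the fundamental lemma of the calculus of variations, which
turns vanishing pairings into vanishing sections and passes operator identities to adjoints
(`sec_eq_zero_of_natPairing`, `dual_sec_eq_zero_of_natPairing`). The other is compactness of the
intersection of a retarded and an advanced support (`isCompact_closure_infl_inter`); it gives both
the adjointness of G and -G* and the equality ker G* = im f*. It is derived from compact causal
diamonds, by way of openness of chronological futures and pasts. -/

namespace CovariantPhaseSpace

/-! ### Fundamental lemma of the calculus of variations for sections and dual densities. -/

section FundamentalLemma

universe u w

variable {n : ℕ} {M : Type w} [TopologicalSpace M] [ChartedSpace (EuclideanSpace ℝ (Fin n)) M]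
  [IsManifold (𝓡 n) ∞ M]

/-- The product of a smooth function and a smooth section. -/
noncomputable def smulSection {Fib : Type*} {E : M → Type*} [NormedAddCommGroup Fib] [NormedSpace ℝ Fib]
    [∀ x, AddCommGroup (E x)] [∀ x, Module ℝ (E x)] [∀ x, TopologicalSpace (E x)]
    [TopologicalSpace (TotalSpace Fib E)] [FiberBundle Fib E] [VectorBundle ℝ Fib E]
    (χ : M → ℝ) (hχ : ContMDiff (𝓡 n) 𝓘(ℝ, ℝ) ∞ χ) (s : ContMDiffSection (𝓡 n) Fib ∞ E) :
    ContMDiffSection (𝓡 n) Fib ∞ E where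
  toFun x := χ x • s x
  contMDiff_toFun := hχ.smul_section s.contMDiff

theorem secSupp_smulSection_isCompact {V : VBundle.{u, w} n M} {χ : M → ℝ}
    (hχ : ContMDiff (𝓡 n) 𝓘(ℝ, ℝ) ∞ χ) (hc : HasCompactSupport χ) (φ : V.Sec) :
    IsCompact (secSupp (smulSection χ hχ φ : V.Sec)) := by
  refine hc.of_isClosed_subset isClosed_closure (closure_mono fun y hy h => hy ?_)
  show χ y • φ y = 0
  rw [h, zero_smul]

/-- Every vector of a fibre is the value of a smooth section of compact support. -/
theorem exists_sec_eq [T2Space M] (V : VBundle.{u, w} n M) (x : M) (v : V.E x) :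
    ∃ s : V.Sec, IsCompact (secSupp s) ∧ s x = v := by
  obtain ⟨t, ht, hs⟩ := FiberBundle.exists_contMDiffOn_extend (k := ∞) (𝓡 n) V.Fib v
  obtain ⟨U, hUt, hU, hxU⟩ := mem_nhds_iff.1 ht
  -- The local extension of `v` is smooth only near `x`; a bump function supported there makes it
  -- global.
  obtain ⟨χ, -, hχ⟩ := (SmoothBumpFunction.nhds_basis_tsupport (I := 𝓡 n) x).mem_iff.1
    (hU.mem_nhds hxU)
  refine ⟨⟨_, ContMDiffOn.smul_section_of_tsupport (χ.contMDiff.contMDiffOn) hU hχ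
    (hs.mono hUt)⟩, ?_, ?_⟩
  · refine χ.hasCompactSupport.of_isClosed_subset isClosed_closure (closure_mono fun y hy h => hy ?_)
    show χ y • FiberBundle.extend V.Fib v y = 0
    rw [h, zero_smul]
  · show χ x • FiberBundle.extend V.Fib v x = v
    rw [χ.eq_one, one_smul, FiberBundle.extend_apply_self]

/-- A norming functional of the vector in the model fibre is an element of the dual fibre, because
the fibre of the density bundle is ℝ; it then extends to a section. -/
theorem exists_dual_sec [T2Space M] {V : VBundle.{u, w} n M} (x : M) (v : V.E x) (hv : v ≠ 0) :
    ∃ β : V.dual.Sec, IsCompact (secSupp β) ∧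
      (show V.E x →L[ℝ] Density n M x from β x) v ≠ 0 := by
  let e := (trivializationAt V.Fib V.E x).continuousLinearEquivAt ℝ x
    (FiberBundle.mem_baseSet_trivializationAt' x)
  obtain ⟨g, -, hg⟩ := exists_dual_vector ℝ (e v) (by simpa using hv)
  let L : V.E x →L[ℝ] Density n M x := (g : V.Fib →L[ℝ] ℝ).comp (e : V.E x →L[ℝ] V.Fib)
  obtain ⟨β, hβ, h⟩ := exists_sec_eq V.dual x L
  refine ⟨β, hβ, ?_⟩
  rw [h]
  show g (e v) ≠ 0
  rw [hg]
  simpa using hv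

/-- The transition factor is the absolute value of a Jacobian, so the sign of a density does not
depend on the chart. This is what lets positivity be read off from the real number `σ x`. -/
theorem densityCoeff_eq (σ : ContMDiffSection (𝓡 n) ℝ ∞ (Density n M)) (c x : M) :
    densityCoeff σ c x = |((tangentBundleCore (𝓡 n) M).coordChange
      (achart (EuclideanSpace ℝ (Fin n)) c) (achart (EuclideanSpace ℝ (Fin n)) x) x).det| *
        (show ℝ from σ x) := rfl

theorem densityCoeff_ne_zero {σ : ContMDiffSection (𝓡 n) ℝ ∞ (Density n M)} {c x : M}
    (hx : x ∈ (chartAt (EuclideanSpace ℝ (Fin n)) c).source) (h : σ x ≠ 0) :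
    densityCoeff σ c x ≠ 0 := by
  let e := (trivializationAt ℝ (Density n M) c).continuousLinearEquivAt ℝ x hx
  show e (σ x) ≠ 0
  simpa using h

variable [T2Space M] [SigmaCompactSpace M]

/-- All chart integrands are non-negative, and the one of a chart whose partition function is
positive at `x` is continuous and positive there, hence positive on an open set, which has positive
Lebesgue measure. -/
theorem integralDensity_pos {σ : ContMDiffSection (𝓡 n) ℝ ∞ (Density n M)}
    (hσ : IsCompact (closure {x | σ x ≠ 0})) (h0 : ∀ x, 0 ≤ (show ℝ from σ x)) {x : M}
    (hx : σ x ≠ 0) : 0 < integralDensity σ := by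
  have hnn : ∀ (c : M) (y : EuclideanSpace ℝ (Fin n)), 0 ≤ chartIntegrand σ c y := fun c y =>
    mul_nonneg ((chartPartition n M).nonneg c _)
      (by rw [densityCoeff_eq]; exact mul_nonneg (abs_nonneg _) (h0 _))
  obtain ⟨c, hc⟩ : ∃ c, 0 < chartPartition n M c x :=
    (chartPartition n M).exists_pos_of_mem (mem_univ x)
  refine finsum_pos (fun c => integral_nonneg fun y => hnn c y) ⟨c, ?_⟩
    (finite_support_chartIntegral hσ)
  have hxc : x ∈ (chartAt (EuclideanSpace ℝ (Fin n)) c).source :=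
    chartPartition_subordinate c (subset_tsupport _ hc.ne')
  have hxe : x ∈ (extChartAt (𝓡 n) c).source := by rwa [extChartAt_source]
  have hmap : MapsTo (extChartAt (𝓡 n) c).symm (extChartAt (𝓡 n) c).target
      (chartAt (EuclideanSpace ℝ (Fin n)) c).source := by
    intro y hy
    rw [← extChartAt_source (𝓡 n)]; exact (extChartAt (𝓡 n) c).map_target hy
  have hcont : ContinuousOn (chartIntegrand σ c) (extChartAt (𝓡 n) c).target := by
    refine ContinuousOn.mul ?_ ?_
    · exact (chartPartition n M c).contMDiff.continuous.comp_continuousOn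
        (continuousOn_extChartAt_symm c)
    · exact (continuousOn_densityCoeff σ c).comp (continuousOn_extChartAt_symm c) hmap
  have hpos : 0 < chartIntegrand σ c (extChartAt (𝓡 n) c x) := by
    refine lt_of_le_of_ne (hnn _ _) (Ne.symm ?_)
    unfold chartIntegrand
    rw [(extChartAt (𝓡 n) c).left_inv hxe]
    exact mul_ne_zero hc.ne' (densityCoeff_ne_zero hxc hx)
  have ho := isOpen_extChartAt_target (I := 𝓡 n) c
  have hyt := (extChartAt (𝓡 n) c).map_source hxe
  rw [setIntegral_pos_iff_support_of_nonneg_ae (Filter.Eventually.of_forall fun y => hnn c y)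
    (integrableOn_chartIntegrand hσ c)]
  have hnh : Function.support (chartIntegrand σ c) ∩ (extChartAt (𝓡 n) c).target ∈
      𝓝 (extChartAt (𝓡 n) c x) := by
    filter_upwards [(hcont.continuousAt (ho.mem_nhds hyt)).eventually (lt_mem_nhds hpos),
      ho.mem_nhds hyt] with y hy hy'
    exact ⟨hy.ne', hy'⟩
  exact Measure.measure_pos_of_mem_nhds _ hnh

/-- A density that does not vanish at `x` has non-zero integral against some bump function. -/
theorem exists_integralDensity_smul_ne_zero (σ : ContMDiffSection (𝓡 n) ℝ ∞ (Density n M)) {x : M}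
    (hx : σ x ≠ 0) : ∃ (χ : M → ℝ) (hχ : ContMDiff (𝓡 n) 𝓘(ℝ, ℝ) ∞ χ), HasCompactSupport χ ∧
      integralDensity (smulSection χ hχ σ) ≠ 0 := by
  -- The coefficient at `x` is non-zero, so either `σ` or `-σ` is positive there.
  wlog hpos : 0 < densityCoeff σ x x generalizing σ
  · have hne := densityCoeff_ne_zero (mem_chart_source (EuclideanSpace ℝ (Fin n)) x) hx
    have hc : densityCoeff ((-1 : ℝ) • σ) x x = -densityCoeff σ x x := by
      rw [densityCoeff_smul _ _ (mem_chart_source (EuclideanSpace ℝ (Fin n)) x)]; ring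
    obtain ⟨χ, hχ, hχc, h⟩ := this ((-1 : ℝ) • σ)
      (by show (-1 : ℝ) • σ x ≠ 0; simpa using hx)
      (by rw [hc]; exact neg_pos.2 (lt_of_le_of_ne (not_lt.1 hpos) hne))
    refine ⟨χ, hχ, hχc, fun h0 => h ?_⟩
    have : smulSection χ hχ ((-1 : ℝ) • σ) = (-1 : ℝ) • smulSection χ hχ σ := by
      ext y
      exact smul_comm (χ y) (-1 : ℝ) (σ y)
    rw [this, integralDensity_smul, h0, mul_zero]
  have hcont : ContinuousAt (densityCoeff σ x) x := (continuousOn_densityCoeff σ x).continuousAt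
    (chart_source_mem_nhds (EuclideanSpace ℝ (Fin n)) x)
  obtain ⟨χ, -, hχ⟩ := (SmoothBumpFunction.nhds_basis_tsupport (I := 𝓡 n) x).mem_iff.1
    (hcont.eventually (lt_mem_nhds hpos))
  refine ⟨χ, χ.contMDiff, χ.hasCompactSupport, (integralDensity_pos (x := x) ?_ ?_ ?_).ne'⟩
  · refine χ.hasCompactSupport.of_isClosed_subset isClosed_closure (closure_mono fun y hy h => hy ?_)
    show χ y • σ y = 0
    rw [h, zero_smul]
  · intro y
    show 0 ≤ χ y * (show ℝ from σ y)
    by_cases hy : y ∈ tsupport χ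
    · have h1 := hχ hy
      -- On the support of the bump the coefficient in the chart at `x` is positive; dividing out
      -- the non-negative Jacobian factor gives positivity of `σ y` itself.
      rw [mem_ofPred_eq, densityCoeff_eq] at h1
      exact mul_nonneg χ.nonneg (pos_of_mul_pos_right h1 (abs_nonneg _)).le
    · rw [image_eq_zero_of_notMem_tsupport hy, zero_mul]
  · show χ x • σ x ≠ 0
    rwa [χ.eq_one, one_smul]

/-- The natural pairing is non-degenerate in the first argument. -/
theorem sec_eq_zero_of_natPairing {V : VBundle.{u, w} n M} {φ : V.Sec}
    (h : ∀ β ∈ secZero V.dual, natPairing φ β = 0) : φ = 0 := by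
  by_contra hne
  obtain ⟨x, hx⟩ : ∃ x, φ x ≠ 0 := by
    by_contra! h'
    exact hne (ContMDiffSection.ext h')
  obtain ⟨β, -, hβ⟩ := exists_dual_sec x (φ x) hx
  obtain ⟨χ, hχ, hc, hi⟩ := exists_integralDensity_smul_ne_zero (pairDensity φ β) hβ
  -- The bump function is absorbed into the test section; only this product, not `β`, has to be
  -- tested.
  exact hi (h (smulSection χ hχ β) (secSupp_smulSection_isCompact hχ hc β))

/-- The natural pairing is non-degenerate in the second argument. -/
theorem dual_sec_eq_zero_of_natPairing {V : VBundle.{u, w} n M} {α : V.dual.Sec}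
    (h : ∀ φ ∈ secZero V, natPairing φ α = 0) : α = 0 := by
  by_contra hne
  obtain ⟨x, hx⟩ : ∃ x, α x ≠ 0 := by
    by_contra! h'
    exact hne (ContMDiffSection.ext h')
  obtain ⟨v, hv⟩ : ∃ v, (show V.E x →L[ℝ] Density n M x from α x) v ≠ 0 := by
    by_contra! h'
    exact hx (ContinuousLinearMap.ext h')
  obtain ⟨φ, -, rfl⟩ := exists_sec_eq V x v
  obtain ⟨χ, hχ, hc, hi⟩ := exists_integralDensity_smul_ne_zero (pairDensity φ α) hv
  refine hi (Eq.trans ?_ (h (smulSection χ hχ φ) (secSupp_smulSection_isCompact hχ hc φ)))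
  unfold natPairing
  congr 1
  ext y
  exact (map_smul (show V.E y →L[ℝ] Density n M y from α y) (χ y) (φ y)).symm

end FundamentalLemma

/-! ### Openness of chronological futures and pasts, and compactness from causal diamonds. -/

section Causality

universe w

variable {n : ℕ} {M : Type w} [TopologicalSpace M] [ChartedSpace (EuclideanSpace ℝ (Fin n)) M]
  [IsManifold (𝓡 n) ∞ M]

/-- Joint continuity in base point and velocity, so that openness of the cone bundle in `TM` can be
pulled back to coordinates. -/
theorem continuousOn_tangent_extChartAt_symm (x : M) :
    ContinuousOn (fun p : EuclideanSpace ℝ (Fin n) × EuclideanSpace ℝ (Fin n) =>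
      (⟨(extChartAt (𝓡 n) x).symm p.1,
        (mfderiv 𝓘(ℝ, EuclideanSpace ℝ (Fin n)) (𝓡 n) (extChartAt (𝓡 n) x).symm p.1 :
          EuclideanSpace ℝ (Fin n) → EuclideanSpace ℝ (Fin n)) p.2⟩ : TangentBundle (𝓡 n) M))
      ((extChartAt (𝓡 n) x).target ×ˢ univ) := by
  have ho := isOpen_extChartAt_target (I := 𝓡 n) x
  have h1 := (contMDiffOn_extChartAt_symm (I := 𝓡 n) (n := ∞) x).continuousOn_tangentMapWithin
    (by simp) ho.uniqueMDiffOn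
  have h2 : Continuous (fun p : EuclideanSpace ℝ (Fin n) × EuclideanSpace ℝ (Fin n) =>
      (⟨p.1, p.2⟩ : TangentBundle 𝓘(ℝ, EuclideanSpace ℝ (Fin n)) (EuclideanSpace ℝ (Fin n)))) :=
    (tangentBundleModelSpaceHomeomorph 𝓘(ℝ, EuclideanSpace ℝ (Fin n))).symm.continuous
  refine (h1.comp h2.continuousOn (fun p hp => hp.1)).congr fun p hp => ?_
  show _ = (⟨_, (mfderivWithin 𝓘(ℝ, EuclideanSpace ℝ (Fin n)) (𝓡 n) (extChartAt (𝓡 n) x).symm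
    (extChartAt (𝓡 n) x).target p.1 :
      EuclideanSpace ℝ (Fin n) → EuclideanSpace ℝ (Fin n)) p.2⟩ : TangentBundle (𝓡 n) M)
  rw [mfderivWithin_of_isOpen ho hp.1]

/-- A straight segment in a chart whose coordinate velocity is mapped into `S` is a curve in `S`. -/
theorem curveIn_of_segment {S : ∀ x : M, Set (TangentSpace (𝓡 n) x)} {x : M}
    {U W : Set (EuclideanSpace ℝ (Fin n))} (hU : Convex ℝ U)
    (hUt : U ⊆ (extChartAt (𝓡 n) x).target)
    (hS : ∀ u ∈ U, ∀ v ∈ W,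
      (mfderiv 𝓘(ℝ, EuclideanSpace ℝ (Fin n)) (𝓡 n) (extChartAt (𝓡 n) x).symm u :
        EuclideanSpace ℝ (Fin n) → EuclideanSpace ℝ (Fin n)) v ∈ S ((extChartAt (𝓡 n) x).symm u))
    {p q : EuclideanSpace ℝ (Fin n)} (hp : p ∈ U) (hq : q ∈ U) {r : ℝ} (hr : 0 < r)
    (hpq : r⁻¹ • (q - p) ∈ W) :
    CurveIn S ((extChartAt (𝓡 n) x).symm p) ((extChartAt (𝓡 n) x).symm q) := by
  set v := r⁻¹ • (q - p) with hv
  let l : ℝ → EuclideanSpace ℝ (Fin n) := fun t => p + t • v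
  have hl : ContMDiff 𝓘(ℝ, ℝ) 𝓘(ℝ, EuclideanSpace ℝ (Fin n)) ∞ l :=
    ContDiff.contMDiff (contDiff_const.add (contDiff_id.smul contDiff_const))
  have hlr : l r = q := by simp [l, hv, smul_smul, hr.ne']
  refine ⟨fun t => (extChartAt (𝓡 n) x).symm (l t), 0, r, hr, by simp [l],
    congrArg (extChartAt (𝓡 n) x).symm hlr, fun t ht => ?_⟩
  -- At time `t` the segment has covered the fraction `t / r` of the way from `p` to `q`.
  have htU : l t ∈ U := by
    have : l t = p + (t / r) • (q - p) := by
      simp only [l, hv, smul_smul, div_eq_mul_inv]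
    rw [this]
    exact hU.add_smul_sub_mem hp hq ⟨div_nonneg ht.1 hr.le, (div_le_one hr).2 ht.2⟩
  have hs : ContMDiffAt 𝓘(ℝ, EuclideanSpace ℝ (Fin n)) (𝓡 n) ∞ (extChartAt (𝓡 n) x).symm (l t) :=
    (contMDiffOn_extChartAt_symm (n := ∞) x).contMDiffAt
      ((isOpen_extChartAt_target x).mem_nhds (hUt htU))
  refine ⟨hs.comp t hl.contMDiffAt, ?_⟩
  have h1 : HasMFDerivAt 𝓘(ℝ, ℝ) 𝓘(ℝ, EuclideanSpace ℝ (Fin n)) l t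
      ((ContinuousLinearMap.id ℝ ℝ).smulRight v) := by
    refine HasFDerivAt.hasMFDerivAt ?_
    exact ((hasFDerivAt_id (𝕜 := ℝ) t).smul_const v).const_add p
  have h3 := (HasMFDerivAt.comp (f := l) t (hs.mdifferentiableAt (by simp)).hasMFDerivAt h1).mfderiv
  have h4 : mfderiv 𝓘(ℝ, ℝ) (𝓡 n) (fun t => (extChartAt (𝓡 n) x).symm (l t)) t = _ := h3
  rw [h4]
  show (mfderiv 𝓘(ℝ, EuclideanSpace ℝ (Fin n)) (𝓡 n) (extChartAt (𝓡 n) x).symm (l t) :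
    EuclideanSpace ℝ (Fin n) → EuclideanSpace ℝ (Fin n)) ((1 : ℝ) • v) ∈
      S ((extChartAt (𝓡 n) x).symm (l t))
  rw [one_smul]
  exact hS _ htU _ hpq

theorem CurveIn.mono {S T : ∀ x : M, Set (TangentSpace (𝓡 n) x)} (h : ∀ x, S x ⊆ T x) {x y : M} :
    CurveIn S x y → CurveIn T x y := fun ⟨γ, a, b, hab, ha, hb, hγ⟩ =>
  ⟨γ, a, b, hab, ha, hb, fun t ht => ⟨(hγ t ht).1, h _ (hγ t ht).2⟩⟩

namespace ChronalCone

variable (C : ChronalCone n M)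

/-- Around a point `γ(b)` of a timelike curve there are a coordinate ball `U` and a set `W` of
velocities containing the difference quotients of `γ` such that straight segments in `U` with
velocity in `W` are timelike. -/
theorem exists_segment_nhds {γ : ℝ → M} {b : ℝ} (hγ : ContMDiffAt 𝓘(ℝ, ℝ) (𝓡 n) ∞ γ b)
    (hv : (mfderiv 𝓘(ℝ, ℝ) (𝓡 n) γ b : ℝ →L[ℝ] TangentSpace (𝓡 n) (γ b)) 1 ∈ C.cone (γ b)) :
    ∃ U W : Set (EuclideanSpace ℝ (Fin n)), IsOpen U ∧ IsOpen W ∧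
      extChartAt (𝓡 n) (γ b) (γ b) ∈ U ∧
      (∀ᶠ t in 𝓝[≠] b, (t - b)⁻¹ •
        (extChartAt (𝓡 n) (γ b) (γ t) - extChartAt (𝓡 n) (γ b) (γ b)) ∈ W) ∧
      ∀ p ∈ U, ∀ q ∈ U, ∀ r : ℝ, 0 < r → r⁻¹ • (q - p) ∈ W →
        CurveIn C.cone ((extChartAt (𝓡 n) (γ b)).symm p) ((extChartAt (𝓡 n) (γ b)).symm q) := by
  set φ := extChartAt (𝓡 n) (γ b) with hφ
  have ht : φ (γ b) ∈ φ.target := mem_extChartAt_target (γ b)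
  have hφγ : MDifferentiableAt 𝓘(ℝ, ℝ) 𝓘(ℝ, EuclideanSpace ℝ (Fin n)) (φ ∘ γ) b :=
    ((contMDiffAt_extChartAt (I := 𝓡 n) (n := ∞)).comp b hγ).mdifferentiableAt (by simp)
  set v := deriv (φ ∘ γ) b
  have hd : HasDerivAt (φ ∘ γ) v b := (mdifferentiableAt_iff_differentiableAt.1 hφγ).hasDerivAt
  have hs : MDifferentiableAt 𝓘(ℝ, EuclideanSpace ℝ (Fin n)) (𝓡 n) φ.symm (φ (γ b)) :=
    ((contMDiffOn_extChartAt_symm (n := ∞) (γ b)).contMDiffAt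
      ((isOpen_extChartAt_target (γ b)).mem_nhds ht)).mdifferentiableAt (by simp)
  have hcomp : HasMFDerivAt 𝓘(ℝ, ℝ) (𝓡 n) (φ.symm ∘ (φ ∘ γ)) b
      ((mfderiv 𝓘(ℝ, EuclideanSpace ℝ (Fin n)) (𝓡 n) φ.symm (φ (γ b))).comp
        ((ContinuousLinearMap.id ℝ ℝ).smulRight v)) := by
    refine HasMFDerivAt.comp (f := φ ∘ γ) b hs.hasMFDerivAt (HasFDerivAt.hasMFDerivAt ?_)
    exact hd.hasFDerivAt
  have heq : γ =ᶠ[𝓝 b] φ.symm ∘ (φ ∘ γ) := by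
    filter_upwards [hγ.continuousAt.eventually (extChartAt_source_mem_nhds (I := 𝓡 n) (γ b))]
      with t h
    exact (φ.left_inv h).symm
  have hvel : (mfderiv 𝓘(ℝ, ℝ) (𝓡 n) γ b : ℝ → EuclideanSpace ℝ (Fin n)) 1 =
      (mfderiv 𝓘(ℝ, EuclideanSpace ℝ (Fin n)) (𝓡 n) φ.symm (φ (γ b)) :
        EuclideanSpace ℝ (Fin n) → EuclideanSpace ℝ (Fin n)) v := by
    have h1 : (mfderiv 𝓘(ℝ, ℝ) (𝓡 n) γ b : ℝ →L[ℝ] EuclideanSpace ℝ (Fin n)) = _ :=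
      (hcomp.congr_of_eventuallyEq heq).mfderiv
    rw [h1]
    show (mfderiv 𝓘(ℝ, EuclideanSpace ℝ (Fin n)) (𝓡 n) φ.symm (φ (γ b)) :
        EuclideanSpace ℝ (Fin n) → EuclideanSpace ℝ (Fin n)) ((1 : ℝ) • v) = _
    rw [one_smul]
  -- The base points `φ.symm (φ (γ b))` and `γ b` are only propositionally equal; viewing vectors in
  -- the model space transports cone membership without casts.
  have hmem : ∀ z, z = γ b → ∀ X : EuclideanSpace ℝ (Fin n),
      X ∈ (C.cone (γ b) : Set (EuclideanSpace ℝ (Fin n))) →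
      X ∈ (C.cone z : Set (EuclideanSpace ℝ (Fin n))) := by
    rintro z rfl X hX
    exact hX
  have hnhds := ((continuousOn_tangent_extChartAt_symm (γ b)).continuousAt
    (((isOpen_extChartAt_target (γ b)).prod isOpen_univ).mem_nhds
      (show (φ (γ b), v) ∈ _ from ⟨ht, mem_univ _⟩))).eventually (C.isOpen_total.mem_nhds
    (by
      show (mfderiv 𝓘(ℝ, EuclideanSpace ℝ (Fin n)) (𝓡 n) φ.symm (φ (γ b)) :
        EuclideanSpace ℝ (Fin n) → EuclideanSpace ℝ (Fin n)) v ∈ C.cone (φ.symm (φ (γ b)))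
      rw [← hvel]
      exact hmem _ (extChartAt_to_inv (γ b)) _ hv))
  -- A product neighbourhood separates the conditions on position and velocity. The position factor
  -- is then shrunk to a ball, whose convexity keeps segments inside.
  rw [nhds_prod_eq, Filter.eventually_prod_iff] at hnhds
  obtain ⟨pU, hpU, pW, hpW, hC⟩ := hnhds
  obtain ⟨ε, hε, hball⟩ := Metric.eventually_nhds_iff_ball.1
    (hpU.and ((isOpen_extChartAt_target (γ b)).mem_nhds ht))
  obtain ⟨W, hW, hWo, hvW⟩ := mem_nhds_iff.1 hpW
  refine ⟨Metric.ball (φ (γ b)) ε, W, Metric.isOpen_ball, hWo, Metric.mem_ball_self hε, ?_, ?_⟩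
  · exact (hasDerivAt_iff_tendsto_slope.1 hd).eventually (hWo.mem_nhds hvW)
  · intro p hp q hq r hr hpq
    exact curveIn_of_segment (convex_ball _ _) (fun u hu => (hball u hu).2)
      (fun u hu v hv => hC (hball u hu).1 (hW hv)) hp hq hr hpq

/-- Cut the curve slightly before its endpoint and join the cut point to `z` by a straight
coordinate segment. Its velocity is close to a difference quotient of the curve, hence in the open
set `W` when `z` is close to `y`. -/
theorem eventually_chron_right {x y : M} (h : CurveIn C.cone x y) : ∀ᶠ z in 𝓝 y, C.Chron x z := by
  obtain ⟨γ, a, b, hab, rfl, rfl, hγ⟩ := h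
  have hb := hγ b (right_mem_Icc.2 hab.le)
  obtain ⟨U, W, hU, hW, hbU, hd, hseg⟩ := C.exists_segment_nhds hb.1 hb.2
  have hc : ContinuousAt (extChartAt (𝓡 n) (γ b)) (γ b) := continuousAt_extChartAt (γ b)
  have h1 : ∀ᶠ t in 𝓝 b, extChartAt (𝓡 n) (γ b) (γ t) ∈ U ∧
      γ t ∈ (extChartAt (𝓡 n) (γ b)).source :=
    ((ContinuousAt.comp (f := γ) hc hb.1.continuousAt).eventually (hU.mem_nhds hbU)).and
      (hb.1.continuousAt.eventually (extChartAt_source_mem_nhds (I := 𝓡 n) (γ b)))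
  obtain ⟨t, ⟨⟨htU, hts⟩, htW⟩, hta, htb⟩ := (((h1.filter_mono nhdsWithin_le_nhds).and
    (hd.filter_mono (nhdsWithin_mono b (s := Iio b) fun t ht => ht.ne))).and
      (Ioo_mem_nhdsLT hab)).exists
  have h2 : ∀ᶠ z in 𝓝 (γ b), (b - t)⁻¹ •
      (extChartAt (𝓡 n) (γ b) z - extChartAt (𝓡 n) (γ b) (γ t)) ∈ W := by
    have h : ContinuousAt (fun z => (b - t)⁻¹ •
      (extChartAt (𝓡 n) (γ b) z - extChartAt (𝓡 n) (γ b) (γ t))) (γ b) :=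
      (hc.fun_sub continuousAt_const).fun_const_smul _
    refine h.eventually (hW.mem_nhds ?_)
    show (b - t)⁻¹ • (extChartAt (𝓡 n) (γ b) (γ b) - extChartAt (𝓡 n) (γ b) (γ t)) ∈ W
    -- Both sign changes of the difference quotient cancel, which turns the slope based at `b` into
    -- the velocity from `γ t` to `γ b`.
    rwa [← neg_sub t b, inv_neg, neg_smul, ← smul_neg, neg_sub]
  filter_upwards [h2, hc.eventually (hU.mem_nhds hbU),
    extChartAt_source_mem_nhds (I := 𝓡 n) (γ b)] with z hz hzU hzs
  have h3 := hseg _ htU _ hzU _ (sub_pos.2 htb) hz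
  rw [PartialEquiv.left_inv _ hts, PartialEquiv.left_inv _ hzs] at h3
  exact .tail (.single ⟨γ, a, t, hta, rfl, rfl, fun s hs => hγ s ⟨hs.1, hs.2.trans htb.le⟩⟩) h3

/-- The time reverse of `eventually_chron_right`: here an initial piece of the curve is replaced. -/
theorem eventually_chron_left {x y : M} (h : CurveIn C.cone x y) : ∀ᶠ z in 𝓝 x, C.Chron z y := by
  obtain ⟨γ, a, b, hab, rfl, rfl, hγ⟩ := h
  have ha := hγ a (left_mem_Icc.2 hab.le)
  obtain ⟨U, W, hU, hW, haU, hd, hseg⟩ := C.exists_segment_nhds ha.1 ha.2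
  have hc : ContinuousAt (extChartAt (𝓡 n) (γ a)) (γ a) := continuousAt_extChartAt (γ a)
  have h1 : ∀ᶠ t in 𝓝 a, extChartAt (𝓡 n) (γ a) (γ t) ∈ U ∧
      γ t ∈ (extChartAt (𝓡 n) (γ a)).source :=
    ((ContinuousAt.comp (f := γ) hc ha.1.continuousAt).eventually (hU.mem_nhds haU)).and
      (ha.1.continuousAt.eventually (extChartAt_source_mem_nhds (I := 𝓡 n) (γ a)))
  obtain ⟨t, ⟨⟨htU, hts⟩, htW⟩, hta, htb⟩ := (((h1.filter_mono nhdsWithin_le_nhds).and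
    (hd.filter_mono (nhdsWithin_mono a (s := Ioi a) fun t ht => ht.ne'))).and
      (Ioo_mem_nhdsGT hab)).exists
  have h2 : ∀ᶠ z in 𝓝 (γ a), (t - a)⁻¹ •
      (extChartAt (𝓡 n) (γ a) (γ t) - extChartAt (𝓡 n) (γ a) z) ∈ W := by
    have h : ContinuousAt (fun z => (t - a)⁻¹ •
      (extChartAt (𝓡 n) (γ a) (γ t) - extChartAt (𝓡 n) (γ a) z)) (γ a) :=
      (continuousAt_const.fun_sub hc).fun_const_smul _
    exact h.eventually (hW.mem_nhds htW)
  filter_upwards [h2, hc.eventually (hU.mem_nhds haU),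
    extChartAt_source_mem_nhds (I := 𝓡 n) (γ a)] with z hz hzU hzs
  have h3 := hseg _ hzU _ htU _ (sub_pos.2 hta) hz
  rw [PartialEquiv.left_inv _ hts, PartialEquiv.left_inv _ hzs] at h3
  exact .head h3 (.single ⟨γ, t, b, htb, rfl, rfl, fun s hs => hγ s ⟨hta.le.trans hs.1, hs.2⟩⟩)

theorem isOpen_chron_right (x : M) : IsOpen {y | C.Chron x y} := by
  refine isOpen_iff_mem_nhds.2 fun y hy => ?_
  rcases Relation.TransGen.tail'_iff.1 hy with ⟨p, hxp, hpy⟩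
  filter_upwards [C.eventually_chron_right hpy] with z hz
  exact Relation.TransGen.trans_right hxp hz

theorem isOpen_chron_left (y : M) : IsOpen {x | C.Chron x y} := by
  refine isOpen_iff_mem_nhds.2 fun x hx => ?_
  rcases Relation.TransGen.head'_iff.1 hx with ⟨p, hxp, hpy⟩
  filter_upwards [C.eventually_chron_left hxp] with z hz
  exact Relation.TransGen.trans_left hz hpy

/-- An open cone containing 0 contains some `v ≠ 0` together with `-v`, against salience. In
dimension zero there is no such `v`, and the cone is `{0}`. -/
theorem zero_notMem_cone (hn : n ≠ 0) (x : M) : (0 : TangentSpace (𝓡 n) x) ∉ C.cone x := by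
  intro h0
  have hc : Continuous (fun v : TangentSpace (𝓡 n) x => (⟨x, v⟩ : TangentBundle (𝓡 n) M)) :=
    (FiberBundle.totalSpaceMk_isInducing (EuclideanSpace ℝ (Fin n)) (TangentSpace (𝓡 n)) x).continuous
  -- Stated in the model space, where the norm is at hand.
  have key : ∀ S : Set (EuclideanSpace ℝ (Fin n)), IsOpen S → 0 ∈ S → ∃ v ∈ S, -v ∈ S ∧ v ≠ 0 := by
    intro S hS h0
    obtain ⟨ε, hε, hball⟩ := Metric.isOpen_iff.1 hS 0 h0
    have : NeZero n := ⟨hn⟩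
    obtain ⟨v, hv⟩ := exists_norm_eq (EuclideanSpace ℝ (Fin n)) (half_pos hε).le
    refine ⟨v, hball ?_, hball ?_, norm_pos_iff.1 (hv ▸ half_pos hε)⟩
    · rw [mem_ball_zero_iff, hv]
      exact half_lt_self hε
    · rw [mem_ball_zero_iff, norm_neg, hv]
      exact half_lt_self hε
  obtain ⟨v, h1, h2, h3⟩ := key (C.cone x) (C.isOpen_total.preimage hc) h0
  exact h3 (C.salient x v (subset_closure h1) (subset_closure h2))

/-- In positive dimension timelike vectors are non-zero, so timelike curves are causal. In dimension
zero the manifold is discrete and every timelike curve is constant; the alternative `x = y` covers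
this case. -/
theorem eq_or_causal_of_chron {x y : M} (h : C.Chron x y) : x = y ∨ C.Causal x y := by
  by_cases hn : n = 0
  · left
    subst hn
    have : DiscreteTopology M := ChartedSpace.discreteTopology (EuclideanSpace ℝ (Fin 0)) M
    have hstep : ∀ p q : M, CurveIn C.cone p q → p = q := by
      rintro p q ⟨γ, a, b, hab, rfl, rfl, hγ⟩
      refine (isPreconnected_Icc.image γ
        fun t ht => (hγ t ht).1.continuousAt.continuousWithinAt).subsingleton ?_ ?_
      · exact mem_image_of_mem γ (left_mem_Icc.2 hab.le)
      · exact mem_image_of_mem γ (right_mem_Icc.2 hab.le)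
    induction h with
    | single h => exact hstep _ _ h
    | tail _ h ih => exact ih.trans (hstep _ _ h)
  · right
    refine Relation.TransGen.mono (fun p q => CurveIn.mono ?_) x y h
    exact fun z v hv => ⟨subset_closure hv, fun h0 => C.zero_notMem_cone hn z (h0 ▸ hv)⟩

/-- Every point `x` is the start of a short curve `γ` with `x ≪ γ(s) ≪ γ(t)` for `0 < s < t < ε`,
and the end of a short curve with the corresponding property. -/
theorem exists_chron_curve (x : M) : ∃ (γ : ℝ → M) (ε : ℝ), 0 < ε ∧ γ 0 = x ∧ ContinuousAt γ 0 ∧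
    ∀ s ∈ Ioo (-ε) ε, ∀ t ∈ Ioo (-ε) ε, s < t → C.Chron (γ s) (γ t) := by
  obtain ⟨γ, ε, hε, h0, hc, hγ⟩ := C.exists_timelike x
  exact ⟨γ, ε, hε, h0, hc, fun s hs t ht hst => .single ⟨γ, s, t, hst, rfl, rfl, fun r hr =>
    hγ r ⟨hs.1.trans_le hr.1, hr.2.trans_lt ht.2⟩⟩⟩

variable {C}

/-- Push `z` forward along a short timelike curve `γ`. For small `t > 0` the past of `γ t` is an
open neighbourhood of `z`, so it meets the future of `x`, and `γ t` lies in the diamond between `x`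
and `γ (ε / 2)`. This diamond is compact, hence closed, and so contains the limit `z` as `t → 0`. -/
theorem closure_chron_right_subset [T2Space M] (hC : C.IsGloballyHyperbolic) (x : M) :
    closure {z | C.Chron x z} ⊆ {z | z = x ∨ C.Causal x z} := by
  intro z hz
  obtain ⟨γ, ε, hε, rfl, hc, hγ⟩ := C.exists_chron_curve z
  have hw : ∀ᶠ t in 𝓝[>] (0 : ℝ), γ t ∈ {z | (z = x ∨ C.Causal x z) ∧
      (z = γ (ε / 2) ∨ C.Causal z (γ (ε / 2)))} := by
    filter_upwards [Ioo_mem_nhdsGT (half_pos hε)] with t ht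
    have h0 : (0 : ℝ) ∈ Ioo (-ε) ε := ⟨by linarith, hε⟩
    have ht' : t ∈ Ioo (-ε) ε := ⟨by linarith [ht.1], by linarith [ht.2]⟩
    have he : ε / 2 ∈ Ioo (-ε) ε := ⟨by linarith, by linarith⟩
    obtain ⟨z', hz', hxz'⟩ := mem_closure_iff.1 hz _ (C.isOpen_chron_left (γ t))
      (hγ 0 h0 t ht' ht.1)
    exact ⟨(C.eq_or_causal_of_chron (Relation.TransGen.trans hxz' hz')).imp_left Eq.symm,
      C.eq_or_causal_of_chron (hγ t ht' _ he ht.2)⟩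
  exact ((hC.compact_diamond x (γ (ε / 2))).isClosed.mem_of_tendsto
    (hc.tendsto.mono_left nhdsWithin_le_nhds) hw).1

theorem closure_chron_left_subset [T2Space M] (hC : C.IsGloballyHyperbolic) (y : M) :
    closure {z | C.Chron z y} ⊆ {z | z = y ∨ C.Causal z y} := by
  intro z hz
  obtain ⟨γ, ε, hε, rfl, hc, hγ⟩ := C.exists_chron_curve z
  have hw : ∀ᶠ t in 𝓝[<] (0 : ℝ), γ t ∈ {z | (z = γ (-(ε / 2)) ∨ C.Causal (γ (-(ε / 2))) z) ∧
      (z = y ∨ C.Causal z y)} := by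
    filter_upwards [Ioo_mem_nhdsLT (neg_lt_zero.2 (half_pos hε))] with t ht
    have h0 : (0 : ℝ) ∈ Ioo (-ε) ε := ⟨by linarith, hε⟩
    have ht' : t ∈ Ioo (-ε) ε := ⟨by linarith [ht.1], by linarith [ht.2]⟩
    have he : -(ε / 2) ∈ Ioo (-ε) ε := ⟨by linarith, by linarith⟩
    obtain ⟨z', hz', hzy'⟩ := mem_closure_iff.1 hz _ (C.isOpen_chron_right (γ t))
      (hγ t ht' 0 h0 ht.2)
    exact ⟨(C.eq_or_causal_of_chron (hγ _ he t ht' ht.1)).imp_left Eq.symm,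
      C.eq_or_causal_of_chron (Relation.TransGen.trans hz' hzy')⟩
  exact ((hC.compact_diamond (γ (-(ε / 2))) y).isClosed.mem_of_tendsto
    (hc.tendsto.mono_left nhdsWithin_le_nhds) hw).2

theorem exists_chron_left (x : M) : ∃ y, C.Chron y x := by
  obtain ⟨γ, ε, hε, rfl, -, hγ⟩ := C.exists_chron_curve x
  exact ⟨γ (-(ε / 2)), hγ _ ⟨by linarith, by linarith⟩ _ ⟨by linarith, hε⟩ (by linarith)⟩

theorem exists_chron_right (x : M) : ∃ y, C.Chron x y := by
  obtain ⟨γ, ε, hε, rfl, -, hγ⟩ := C.exists_chron_curve x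
  exact ⟨γ (ε / 2), hγ _ ⟨by linarith, hε⟩ _ ⟨by linarith, by linarith⟩ (by linarith)⟩

/-- Every point has a chronological predecessor, so the open futures of points cover `K`. A finite
subcover reduces the closure to that of finitely many futures of single points. -/
theorem closure_infl_future_subset [T2Space M] (hC : C.IsGloballyHyperbolic) {K : Set M}
    (hK : IsCompact K) :
    ∃ T : Finset M, closure (C.infl .future K) ⊆ ⋃ x ∈ T, {z | z = x ∨ C.Causal x z} := by
  obtain ⟨T, hT⟩ := hK.elim_finite_subcover (fun x : M => {z | C.Chron x z})
    C.isOpen_chron_right fun z _ => mem_iUnion.2 (C.exists_chron_left z)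
  refine ⟨T, ?_⟩
  have h1 : C.infl .future K ⊆ ⋃ x ∈ T, {z | C.Chron x z} := by
    rintro z ⟨p, hp, hpz⟩
    obtain ⟨x, hx, hxp⟩ := mem_iUnion₂.1 (hT hp)
    exact mem_iUnion₂.2 ⟨x, hx, Relation.TransGen.trans hxp hpz⟩
  refine (closure_mono h1).trans ?_
  rw [Finset.closure_biUnion]
  exact iUnion₂_mono fun x _ => closure_chron_right_subset hC x

theorem closure_infl_past_subset [T2Space M] (hC : C.IsGloballyHyperbolic) {K : Set M}
    (hK : IsCompact K) :
    ∃ T : Finset M, closure (C.infl .past K) ⊆ ⋃ y ∈ T, {z | z = y ∨ C.Causal z y} := by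
  obtain ⟨T, hT⟩ := hK.elim_finite_subcover (fun y : M => {z | C.Chron z y})
    C.isOpen_chron_left fun z _ => mem_iUnion.2 (C.exists_chron_right z)
  refine ⟨T, ?_⟩
  have h1 : C.infl .past K ⊆ ⋃ y ∈ T, {z | C.Chron z y} := by
    rintro z ⟨p, hp, hpz⟩
    obtain ⟨y, hy, hxp⟩ := mem_iUnion₂.1 (hT hp)
    exact mem_iUnion₂.2 ⟨y, hy, Relation.TransGen.trans hpz hxp⟩
  refine (closure_mono h1).trans ?_
  rw [Finset.closure_biUnion]
  exact iUnion₂_mono fun x _ => closure_chron_left_subset hC x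

/-- By the two finite covers, the intersection is a closed subset of a finite union of causal
diamonds. -/
theorem isCompact_closure_infl_inter [T2Space M] (hC : C.IsGloballyHyperbolic) {K L : Set M}
    (hK : IsCompact K) (hL : IsCompact L) :
    IsCompact (closure (C.infl .future K) ∩ closure (C.infl .past L)) := by
  obtain ⟨S, hS⟩ := closure_infl_future_subset hC hK
  obtain ⟨T, hT⟩ := closure_infl_past_subset hC hL
  refine (S.isCompact_biUnion fun x _ => T.isCompact_biUnion fun y _ =>
    hC.compact_diamond x y).of_isClosed_subset (isClosed_closure.inter isClosed_closure) ?_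
  rintro z ⟨h1, h2⟩
  obtain ⟨x, hx, hxz⟩ := mem_iUnion₂.1 (hS h1)
  obtain ⟨y, hy, hzy⟩ := mem_iUnion₂.1 (hT h2)
  exact mem_iUnion₂.2 ⟨x, hx, mem_iUnion₂.2 ⟨y, hy, hxz, hzy⟩⟩

end ChronalCone

end Causality

/-! ### Green functions: intertwining, kernel and adjoints. -/

section GreenFunctions

universe u w

variable {n : ℕ} {M : Type w} [TopologicalSpace M] [ChartedSpace (EuclideanSpace ℝ (Fin n)) M]
  [IsManifold (𝓡 n) ∞ M]

namespace IsGreenHyperbolic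

variable {C : ChronalCone n M} {V W : VBundle.{u, w} n M} {f : DiffOp V V.dual}

theorem greenSC_mem (hf : IsGreenHyperbolic C f) (d : TimeDir) (α : secZero V.dual) :
    (hf.greenSC d α : V.Sec) ∈ C.secDir d V :=
  (hf.green d (Submodule.inclusion (C.secZero_le_secDir d V.dual) α)).2

theorem eq_of_op_eq (hf : IsGreenHyperbolic C f) {d : TimeDir} {φ ψ : V.Sec}
    (hφ : φ ∈ C.secDir d V) (hψ : ψ ∈ C.secDir d V) (h : f φ = f ψ) : φ = ψ :=
  congrArg Subtype.val ((hf.existsUnique d (f.onDir C d ⟨φ, hφ⟩)).unique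
    (y₁ := ⟨φ, hφ⟩) (y₂ := ⟨ψ, hψ⟩) rfl (Subtype.ext h.symm))

/-- A differential operator intertwining two Green hyperbolic operators intertwines their Green
functions. -/
theorem apply_greenSC {h : DiffOp W W.dual} (hf : IsGreenHyperbolic C f)
    (hh : IsGreenHyperbolic C h) {c : DiffOp V W} {q : DiffOp V.dual W.dual}
    (hc : ∀ φ, h (c φ) = q (f φ)) (d : TimeDir) (α : secZero V.dual) :
    c (hf.greenSC d α : V.Sec) = hh.greenSC d (q.on0 α) := by
  -- Both sides have support in direction `d` and the same image under `h`, so uniqueness of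
  -- solutions identifies them.
  refine hh.eq_of_op_eq (d := d) ?_ (hh.greenSC_mem d _) ?_
  · exact (c.onDir C d ⟨_, hf.greenSC_mem d α⟩).2
  · rw [hc, hf.op_greenSC, hh.op_greenSC]
    rfl

theorem apply_causal {h : DiffOp W W.dual} (hf : IsGreenHyperbolic C f)
    (hh : IsGreenHyperbolic C h) {c : DiffOp V W} {q : DiffOp V.dual W.dual}
    (hc : ∀ φ, h (c φ) = q (f φ)) (α : secZero V.dual) :
    c.onSC C (hf.causal α) = hh.causal (q.on0 α) := by
  apply Subtype.ext
  show c.toLin ((hf.greenSC .future α : V.Sec) - (hf.greenSC .past α : V.Sec)) =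
    (hh.greenSC .future (q.on0 α) : W.Sec) - (hh.greenSC .past (q.on0 α) : W.Sec)
  rw [map_sub]
  exact congrArg₂ _ (hf.apply_greenSC hh hc .future α) (hf.apply_greenSC hh hc .past α)

/-- A section of compact support is at once the retarded and the advanced solution for its own
source; hence G ∘ f = 0 in `causal_op`. -/
theorem greenSC_op (hf : IsGreenHyperbolic C f) (d : TimeDir) (ρ : secZero V) :
    (hf.greenSC d (f.on0 ρ) : V.Sec) = ρ :=
  hf.eq_of_op_eq (hf.greenSC_mem d _) (C.secZero_le_secDir d V ρ.2) (hf.op_greenSC d _)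

theorem causal_op (hf : IsGreenHyperbolic C f) (ρ : secZero V) : hf.causal (f.on0 ρ) = 0 := by
  apply Subtype.ext
  show (hf.greenSC .future (f.on0 ρ) : V.Sec) - (hf.greenSC .past (f.on0 ρ) : V.Sec) = 0
  rw [hf.greenSC_op, hf.greenSC_op, sub_self]

theorem isCompact_inter [T2Space M] (hC : C.IsGloballyHyperbolic) {V W : VBundle.{u, w} n M}
    {φ : V.Sec} {ψ : W.Sec} (hφ : φ ∈ C.secDir .future V) (hψ : ψ ∈ C.secDir .past W) :
    IsCompact (secSupp φ ∩ secSupp ψ) := by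
  obtain ⟨K, hK, h1⟩ := hφ
  obtain ⟨L, hL, h2⟩ := hψ
  exact (ChronalCone.isCompact_closure_infl_inter hC hK hL).of_isClosed_subset
    (isClosed_closure.inter isClosed_closure) (inter_subset_inter h1 h2)

/-- The kernel of the causal Green function consists of the images of sections of compact
support. -/
theorem mem_range_of_causal_eq_zero [T2Space M] (hC : C.IsGloballyHyperbolic)
    (hf : IsGreenHyperbolic C f) {α : secZero V.dual} (h : hf.causal α = 0) :
    α ∈ LinearMap.range f.on0 := by
  have h1 : (hf.greenSC .future α : V.Sec) - (hf.greenSC .past α : V.Sec) = 0 :=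
    congrArg Subtype.val h
  -- The retarded and advanced solutions coincide, so their common support is both past- and
  -- future-bounded, hence compact. This one section is the required preimage of `α`.
  have h2 := isCompact_inter hC (hf.greenSC_mem .future α) (hf.greenSC_mem .past α)
  rw [← sub_eq_zero.1 h1, inter_self] at h2
  exact ⟨⟨_, h2⟩, Subtype.ext (hf.op_greenSC .future α)⟩

end IsGreenHyperbolic

variable [T2Space M] [SigmaCompactSpace M]

namespace HyperbolicOp

variable {C : ChronalCone n M} {V : VBundle.{u, w} n M}

/-- `G` and `-G*` are adjoint. -/
theorem pairSC_G (hC : C.IsGloballyHyperbolic) (f : HyperbolicOp C V) (α β : secZero V.dual) :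
    pairSC C V (f.G β) α = -pairSC C V (f.Gadj α) β := by
  -- With α = f* G*₋ α and β = f G₊ β, moving f across the pairing shows that G₊ and G*₋ are
  -- adjoint. The opposite time directions make the supports meet in a compact set; exchanging the
  -- directions, as in `h2`, produces the minus sign for the differences.
  have h1 : pairSC C V (f.green.greenSC .future β) α =
      pairSC C V (f.green_adj.greenSC .past α) β := by
    have h := f.isAdjoint (f.green.greenSC .future β) (f.green_adj.greenSC .past α)
      (IsGreenHyperbolic.isCompact_inter hC (f.green.greenSC_mem _ _)
        (f.green_adj.greenSC_mem _ _))
    rw [f.green.op_greenSC, f.green_adj.op_greenSC] at h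
    exact h.symm
  have h2 : pairSC C V (f.green.greenSC .past β) α =
      pairSC C V (f.green_adj.greenSC .future α) β := by
    have h := f.isAdjoint (f.green.greenSC .past β) (f.green_adj.greenSC .future α)
      (inter_comm _ _ ▸ IsGreenHyperbolic.isCompact_inter hC (f.green_adj.greenSC_mem _ _)
        (f.green.greenSC_mem _ _))
    rw [f.green.op_greenSC, f.green_adj.op_greenSC] at h
    exact h.symm
  show pairSC C V (f.green.greenSC .future β - f.green.greenSC .past β) α =
    -pairSC C V (f.green_adj.greenSC .future α - f.green_adj.greenSC .past α) β
  rw [map_sub, map_sub, LinearMap.sub_apply, LinearMap.sub_apply, h1, h2]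
  ring

end HyperbolicOp

theorem secSC_eq_zero_of_pairSC {C : ChronalCone n M} {V : VBundle.{u, w} n M} {φ : C.secSC V}
    (h : ∀ β, pairSC C V φ β = 0) : φ = 0 :=
  Subtype.ext (sec_eq_zero_of_natPairing fun β hβ => h ⟨β, hβ⟩)

/-- The adjoint of an intertwining relation `h ∘ c = q ∘ f`. -/
theorem adj_intertwining {C : ChronalCone n M} {V W : VBundle.{u, w} n M} {f : HyperbolicOp C V}
    {h : HyperbolicOp C W} {c : DiffOp V W} {cAdj : DiffOp W.dual V.dual}
    {q : DiffOp V.dual W.dual} {qAdj : DiffOp W V} (hc : IsAdjoint c cAdj) (hq : IsAdjoint qAdj q)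
    (hcf : ∀ φ, h.op (c φ) = q (f.op φ)) (ξ : W.Sec) :
    f.adj (qAdj ξ) = cAdj (h.adj ξ) := by
  rw [← sub_eq_zero]
  refine dual_sec_eq_zero_of_natPairing fun φ hφ => ?_
  have hφ' : IsCompact (secSupp φ) := hφ
  have hcpt : ∀ {V : VBundle.{u, w} n M} (α : V.Sec), IsCompact (secSupp φ ∩ secSupp α) :=
    fun α => hφ'.inter_right isClosed_closure
  have hcpt' : ∀ {V W : VBundle.{u, w} n M} (β : V.Sec) (α : W.Sec), secSupp β ⊆ secSupp φ →
      IsCompact (secSupp β ∩ secSupp α) := fun β α hβ =>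
    (hφ'.of_isClosed_subset isClosed_closure hβ).inter_right isClosed_closure
  -- The chain is ⟨φ, f* q* ξ⟩ = ⟨q* ξ, f φ⟩ = ⟨ξ, q f φ⟩ = ⟨ξ, h c φ⟩ = ⟨c φ, h* ξ⟩ = ⟨φ, c* h* ξ⟩.
  -- Each move is legitimate for arbitrary `ξ` because differential operators do not enlarge the
  -- compact support of `φ`.
  have e1 : natPairing φ (f.adj (qAdj ξ)) = natPairing (qAdj ξ) (f.op φ) :=
    (f.isAdjoint φ (qAdj ξ) (hcpt _)).symm
  have e2 : natPairing (qAdj ξ) (f.op φ) = natPairing ξ (q (f.op φ)) :=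
    hq ξ (f.op φ) (inter_comm _ _ ▸ hcpt' _ _ (f.op.supp_subset φ))
  have e3 : natPairing ξ (h.op (c φ)) = natPairing (c φ) (h.adj ξ) :=
    h.isAdjoint (c φ) ξ (hcpt' _ _ (c.supp_subset φ))
  have e4 : natPairing (c φ) (h.adj ξ) = natPairing φ (cAdj (h.adj ξ)) := hc φ _ (hcpt _)
  have e5 : natPairing φ (f.adj (qAdj ξ)) = natPairing φ (cAdj (h.adj ξ)) := by
    rw [e1, e2, ← hcf, e3, e4]
  rw [sub_eq_add_neg, ← neg_one_smul ℝ, natPairing_add_right (hcpt _) (hcpt _),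
    natPairing_smul_right, e5]
  ring

end GreenFunctions

/-! ### Non-degeneracy of the pairing of formal tangent and cotangent spaces. -/

section Nondegeneracy

universe u w

variable {n : ℕ} {M : Type w} [TopologicalSpace M] [ChartedSpace (EuclideanSpace ℝ (Fin n)) M]
  [IsManifold (𝓡 n) ∞ M] [T2Space M] [SigmaCompactSpace M]

section Subquot

variable {X Y : Type*} [AddCommGroup X] [Module ℝ X] [AddCommGroup Y] [Module ℝ Y]
  {p : X →ₗ[ℝ] Y →ₗ[ℝ] ℝ} {ZX BX : Submodule ℝ X} {ZY BY : Submodule ℝ Y}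
  {hX : ∀ x ∈ BX, x ∈ ZX → ∀ y ∈ ZY, p x y = 0} {hY : ∀ x ∈ ZX, ∀ y ∈ BY, p x y = 0}

/-- Non-degeneracy in terms of representatives: the quotient is by `Z ∩ B`, so for an element of `Z`
a vanishing class means just membership in `B`. -/
theorem subquotPairing_separatingLeft_iff :
    (subquotPairing p ZX BX ZY BY hX hY).SeparatingLeft ↔
      ∀ x ∈ ZX, (∀ y ∈ ZY, p x y = 0) → x ∈ BX := by
  constructor
  · intro h x hx hxy
    have := h (Submodule.Quotient.mk ⟨x, hx⟩) fun y => by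
      obtain ⟨y, rfl⟩ := Submodule.Quotient.mk_surjective _ y
      exact hxy y y.2
    exact (Submodule.Quotient.mk_eq_zero (BX.submoduleOf ZX)).1 this
  · intro h x hxy
    obtain ⟨x, rfl⟩ := Submodule.Quotient.mk_surjective _ x
    exact (Submodule.Quotient.mk_eq_zero _).2
      (h x x.2 fun y hy => hxy (Submodule.Quotient.mk ⟨y, hy⟩))

theorem subquotPairing_separatingRight_iff :
    (subquotPairing p ZX BX ZY BY hX hY).SeparatingRight ↔
      ∀ y ∈ ZY, (∀ x ∈ ZX, p x y = 0) → y ∈ BY := by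
  constructor
  · intro h y hy hxy
    have := h (Submodule.Quotient.mk ⟨y, hy⟩) fun x => by
      obtain ⟨x, rfl⟩ := Submodule.Quotient.mk_surjective _ x
      exact hxy x x.2
    exact (Submodule.Quotient.mk_eq_zero (BY.submoduleOf ZY)).1 this
  · intro h y hxy
    obtain ⟨y, rfl⟩ := Submodule.Quotient.mk_surjective _ y
    exact (Submodule.Quotient.mk_eq_zero _).2
      (h y y.2 fun x hx => hxy (Submodule.Quotient.mk ⟨x, hx⟩))

end Subquot

variable {C : ChronalCone n M} {F E E' P P' : VBundle.{u, w} n M} {f : HyperbolicOp C F}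
  (𝒞 : Constraints f E E') (𝒢 : Gauge f P P')

/-- The causal Green function maps cocycles to linearized solutions. -/
theorem G_mem_linSolutions {β : secZero F.dual} (hβ : β ∈ 𝒞.solCocycles) :
    f.G β ∈ linSolutions 𝒞 := by
  obtain ⟨ρ, hρ⟩ := hβ
  refine ⟨f.green.op_causal β, ?_⟩
  show 𝒞.c.onSC C (f.G β) = 0
  -- c G β = H q β = H h ρ = 0.
  exact (f.green.apply_causal 𝒞.h.green 𝒞.h_c β).trans (hρ ▸ 𝒞.h.green.causal_op ρ)

/-- A compactly supported dual density that annihilates all linearized solutions is trivial. -/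
theorem mem_trivialDuals_of_forall_pairSC (hC : C.IsGloballyHyperbolic)
    (hpar : 𝒞.GloballyParametrizable) {α : secZero F.dual}
    (hα : ∀ ψ ∈ linSolutions 𝒞, pairSC C F ψ α = 0) : α ∈ trivialDuals 𝒞 := by
  have hpair : ∀ β ∈ 𝒞.solCocycles, pairSC C F (f.Gadj α) β = 0 := fun β hβ => by
    have h := f.pairSC_G hC α β
    rw [hα _ (G_mem_linSolutions 𝒞 hβ)] at h
    linarith
  -- Every q'[β] is a cocycle, with witness 0 for membership in the image of h, since q ∘ q' = 0.
  have hq' : 𝒞.q'Adj.onSC C (f.Gadj α) = 0 := by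
    refine secSC_eq_zero_of_pairSC fun β => ?_
    rw [pairSC_adj 𝒞.isAdjoint_q']
    refine hpair _ ⟨0, ?_⟩
    rw [map_zero]
    exact Subtype.ext (𝒞.q_q' β).symm
  -- Parametrizability enters here: the class of G*[α] pairs to zero with every cocycle class, so
  -- G*[α] = q* H* ε.
  obtain ⟨_, ⟨ε, rfl⟩, hε⟩ := subquotPairing_separatingLeft_iff.1 hpar.1 (f.Gadj α)
    ⟨⟨α, rfl⟩, hq'⟩ hpair
  -- The adjoint relation f* ∘ q* = c* ∘ h* makes q* intertwine the Green functions of h* and f*.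
  have hG : f.Gadj (𝒞.cAdj.on0 ε) = 𝒞.qAdj.onSC C (𝒞.h.Gadj ε) :=
    (𝒞.h.green_adj.apply_causal f.green_adj
      (adj_intertwining 𝒞.isAdjoint_c 𝒞.isAdjoint_q 𝒞.h_c) ε).symm
  have hker : α - 𝒞.cAdj.on0 ε ∈ LinearMap.range f.adj.on0 := by
    refine f.green_adj.mem_range_of_causal_eq_zero hC ?_
    show f.Gadj (α - 𝒞.cAdj.on0 ε) = 0
    rw [map_sub, hG, hε, sub_self]
  rw [← sub_add_cancel α (𝒞.cAdj.on0 ε)]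
  exact add_mem (Submodule.mem_sup_left hker) (Submodule.mem_sup_right ⟨ε, rfl⟩)

/-- The adjoint of g' ∘ g = 0, obtained by testing against compactly supported gauge parameters. -/
theorem gAdj_g'Adj (β : secZero P'.dual) : 𝒢.gAdj.on0 (𝒢.g'Adj.on0 β) = 0 := by
  refine Subtype.ext (dual_sec_eq_zero_of_natPairing fun ε hε => ?_)
  let ε' : C.secSC P := ⟨ε, (C.secDir_le_secSC .future P) (C.secZero_le_secDir .future P hε)⟩
  show pairSC C P ε' (𝒢.gAdj.on0 (𝒢.g'Adj.on0 β)) = 0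
  have h : 𝒢.g'.onSC C (𝒢.g.onSC C ε') = 0 := Subtype.ext (𝒢.g'_g ε)
  rw [← pairSC_adj 𝒢.isAdjoint_g, ← pairSC_adj 𝒢.isAdjoint_g', h, map_zero, LinearMap.zero_apply]

/-- A spacelike compact section that annihilates all gauge invariant dual densities is pure
gauge. -/
theorem mem_range_g_of_forall_pairSC (hrec : 𝒢.GloballyRecognizable) {ψ : C.secSC F}
    (hψ : ∀ α ∈ LinearMap.ker 𝒢.gAdj.on0, pairSC C F ψ α = 0) :
    ψ ∈ LinearMap.range (𝒢.g.onSC C) := by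
  refine subquotPairing_separatingLeft_iff.1 hrec.1 ψ ?_ hψ
  rw [LinearMap.mem_ker]
  refine secSC_eq_zero_of_pairSC fun β => ?_
  rw [pairSC_adj 𝒢.isAdjoint_g']
  exact hψ _ (gAdj_g'Adj 𝒢 β)

/-- Exactly gauge invariant covectors are gauge invariant up to the zero trivial covector. This
passes from the covectors of the formal cotangent space to those of the gauge cohomology. -/
theorem ker_gAdj_le_gaugeInvDuals : LinearMap.ker 𝒢.gAdj.on0 ≤ gaugeInvDuals 𝒞 𝒢 :=
  fun _ hα => ⟨0, zero_mem _, by rw [map_zero, LinearMap.mem_ker.1 hα]⟩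

end Nondegeneracy

end CovariantPhaseSpace

theorem mainTheorem3 {n : ℕ} {M : Type*} [TopologicalSpace M]
    [ChartedSpace (EuclideanSpace ℝ (Fin n)) M] [IsManifold (𝓡 n) ∞ M]
    [T2Space M] [SigmaCompactSpace M]
    (C : ChronalCone n M) (hC : C.IsGloballyHyperbolic)
    {F E E' P P' : VBundle n M} (f : HyperbolicOp C F)
    (𝒞 : Constraints f E E') (𝒢 : Gauge f P P')
    (hpar : 𝒞.GloballyParametrizable) (hrec : 𝒢.GloballyRecognizable) :
    (sbarPairing 𝒞 𝒢).Nondegenerate := by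
  constructor
  · exact subquotPairing_separatingLeft_iff.2 fun ψ _ hψ =>
      mem_range_g_of_forall_pairSC 𝒢 hrec fun α hα => hψ α (ker_gAdj_le_gaugeInvDuals 𝒞 𝒢 hα)
  · exact subquotPairing_separatingRight_iff.2 fun α _ hα =>
      mem_trivialDuals_of_forall_pairSC 𝒞 hC hpar hα
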